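/- All graphs are simple. A set $X$ of vertices of a graph $G$ is \emph{conformal} if $G-X$ has a perfect matching, and a subgraph of $G$ is conformal if its vertex set is. A \emph{bicontraction} takes a vertex $v$ with exactly two neighbours $u_0,u_1$, contracts $\{v,u_0,u_1\}$ to a single vertex, and deletes resulting loops and parallel edges. A graph $H$ is a \emph{matching minor} of $G$ if, up to isomorphism, it is obtained from a conformal subgraph of $G$ by a (possibly empty) sequence of bicontractions. A graph is \emph{matching covered} if it is connected and each of its edges lies in a perfect matching. The \emph{shallow vortex matching grid} $\mathrm{SVMG}_k$ of order $k$ consists of $2k$ vertex-disjoint cycles $C_i=(v^i_1,v^i_2,\dots,v^i_{8k})$, $i\in\{1,\dots,2k\}$, of length $8k$, together with the edges $v^i_j v^{i+1}_{j+1}$ for $1\le i\le 2k-1$ and $j\in\{1,5,9,\dots,8k-3\}$, $v^i_j v^{i-1}_{j+1}$ for $2\le i\le 2k$ and $j\in\{3,7,11,\dots,8k-1\}$, and $v^1_j v^1_{(j+5)\bmod 8k}$ for $j\in\{2,6,10,\dots,8k-2\}$. A \emph{shallow vortex matching minor} is a bipartite matching covered graph that is a matching minor of $\mathrm{SVMG}_k$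 for some $k$. For a bipartite graph $B$ let $\mu(B)$ be the maximum $t$ such that $K_{t,t}$ is a matching minor of $B$. \textbf{Corollary.} $K_{5,5}$ is not a matching minor of $\mathrm{SVMG}_k$ for any $k$; in particular $K_{5,5}$ is not a shallow vortex matching minor. Equivalently, for every shallow vortex matching minor $B$ the maximum $\mu(B)$ exists and satisfies $\mu(B)\le 4$. -/

import Mathlib

/-- `H` is (up to the names of its vertices) a *bicontraction* of `G`: there is a vertex `v` of degree
two in `G`, with neighbours `u₀ ≠ u₁`, such that `H` arises from `G` by contracting `{v, u₀, u₁}` into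
a single vertex and removing the loops and parallel edges that arise. The map `f` is the quotient
map of this contraction. -/
def IsBicontraction {V : Type*} {W : Type*} (G : SimpleGraph V) (H : SimpleGraph W) : Prop :=
  ∃ v u₀ u₁ : V, u₀ ≠ u₁ ∧ G.neighborSet v = {u₀, u₁} ∧
    ∃ f : V → W, Function.Surjective f ∧
      (∀ a b : V, f a = f b ↔
        a = b ∨ (a ∈ ({v, u₀, u₁} : Set V) ∧ b ∈ ({v, u₀, u₁} : Set V))) ∧
      ∀ x y : W, H.Adj x y ↔ x ≠ y ∧ ∃ a b : V, f a = x ∧ f b = y ∧ G.Adj a b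

/-- `BicontractsTo H G`: a graph isomorphic to `H` is obtained from `G` by a finite (possibly empty)
sequence of bicontractions. -/
inductive BicontractsTo.{u, w} {W : Type w} (H : SimpleGraph W) :
    ∀ {V : Type u}, SimpleGraph V → Prop
  | iso {V : Type u} (G : SimpleGraph V) (e : G ≃g H) : BicontractsTo H G
  | step {V V' : Type u} (G : SimpleGraph V) (G' : SimpleGraph V')
      (h : IsBicontraction G G') (h' : BicontractsTo H G') : BicontractsTo H G

/-- A set `X` of vertices of `G` is *conformal* if `G - X` has a perfect matching. -/
def IsConformalSet {V : Type*} (G : SimpleGraph V) (X : Set V) : Prop :=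
  ∃ M : (G.induce Xᶜ).Subgraph, M.IsPerfectMatching

/-- `H` is a *matching minor* of `G`: it is obtained (up to isomorphism) from a conformal subgraph
of `G` by bicontractions. -/
def IsMatchingMinor {W V : Type*} (H : SimpleGraph W) (G : SimpleGraph V) : Prop :=
  ∃ S : G.Subgraph, IsConformalSet G S.verts ∧ BicontractsTo H S.coe

/-- A graph is *matching covered* if it is connected and each of its edges lies in a perfect
matching. -/
def IsMatchingCovered {V : Type*} (G : SimpleGraph V) : Prop :=
  G.Connected ∧ ∀ e ∈ G.edgeSet, ∃ M : G.Subgraph, M.IsPerfectMatching ∧ e ∈ M.edgeSet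

/-- The *shallow vortex matching grid* of order `k`. The pair `(i, j)` stands for the vertex
`v_{j+1}^{i+1}`, the `(j+1)`-st vertex of the `(i+1)`-st of the `2k` cycles of length `8k`
(positions and cycles are counted from `0` here). The four kinds of edges are, in this order:
the edges of the cycles, the two kinds of edges between consecutive cycles, and the crossing edges
on the first cycle. -/
def shallowVortexMatchingGrid (k : ℕ) : SimpleGraph (Fin (2 * k) × Fin (8 * k)) :=
  SimpleGraph.fromRel fun a b =>
    (b.1 = a.1 ∧ (b.2 : ℕ) = ((a.2 : ℕ) + 1) % (8 * k)) ∨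
    ((b.1 : ℕ) = (a.1 : ℕ) + 1 ∧ (a.2 : ℕ) % 4 = 0 ∧ (b.2 : ℕ) = (a.2 : ℕ) + 1) ∨
    ((a.1 : ℕ) = (b.1 : ℕ) + 1 ∧ (a.2 : ℕ) % 4 = 2 ∧ (b.2 : ℕ) = (a.2 : ℕ) + 1) ∨
    ((a.1 : ℕ) = 0 ∧ (b.1 : ℕ) = 0 ∧ (a.2 : ℕ) % 4 = 1 ∧
      (b.2 : ℕ) = ((a.2 : ℕ) + 5) % (8 * k))

/-- A *shallow vortex matching minor* is a bipartite matching covered graph that is a matching minor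
of a shallow vortex matching grid of some order. -/
def IsShallowVortexMatchingMinor {V : Type*} (B : SimpleGraph V) : Prop :=
  B.IsBipartite ∧ IsMatchingCovered B ∧ ∃ k : ℕ, IsMatchingMinor B (shallowVortexMatchingGrid k)

/-- The set of all `t` such that `K_{t,t}` is a matching minor of `B`. -/
def bicliqueMatchingMinorOrders {V : Type*} (B : SimpleGraph V) : Set ℕ :=
  {t : ℕ | IsMatchingMinor (completeBipartiteGraph (Fin t) (Fin t)) B}

/-- `μ(B)`: the largest `t` such that `K_{t,t}` is a matching minor of `B`. -/
noncomputable def bicliqueMatchingNumber {V : Type*} (B : SimpleGraph V) : ℕ :=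
  sSup (bicliqueMatchingMinorOrders B)

/-!
The graph `K_{5,5}` is not even an ordinary minor of a shallow vortex matching grid. A matching
minor is a minor (`IsMatchingMinor.hasMinor`), and `K_{5,5}` is a minor of `K_{t,t}` for `t ≥ 5`, so
this gives all the upper bounds. That the maximum exists also needs some `K_{t,t}` to be a matching
minor of `B` at all; `K_{0,0}` is one because `B` has a perfect matching: the only matching covered
graph without one is `K_1`, which is not a matching minor of the grid since the parity of the number
of vertices is preserved.

The grid without the crossing edges on its first cycle, the *ring*, is planar and can be drawn in a
half-plane with the ring on the boundary. Every vertex of the ring is passed over by a single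
crossing edge, whose first end is its *gate*. So if `x` and `y` are joined by a planar connection
`P`, then a connected set disjoint from `P` that meets the ring on both sides of the pair `x`, `y`
has to contain the gate of `x` or that of `y` (`VortexSociety.inside_iff_of_barrier`): the first
cycle is a vortex of depth one. This is all that is used of the grid, and it is axiomatized in
`VortexSociety`. The drawing enters only through the parities of the crossings of edges with
vertical rays; from these one obtains that disjoint connections do not interleave on the ring
(`VortexSociety.noncrossing`), that the planar part has no `K_{3,3}` minor
(`VortexSociety.no_planar_K33`), and that it has no `K_{2,3}` minor whose three branch sets on one
side meet the ring (`VortexSociety.no_planar_K23`).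

For a model of `K_{5,5}`, let `p ≥ q` be the numbers of branch sets of the two colours that avoid
the ring. Such branch sets are planar, and they are joined to the branch sets of the other colour
that meet the ring by planar *legs* ending on the ring.

* If `p + q ≤ 3`, each branch set off the ring can be merged with one of the other colour that meets
  the ring. The outcome is a 5-connected minor with at least seven branch sets, all of which meet
  the ring. Triangulating the outer face by pairs of ring vertices that are linked or consecutive
  leads to a contradiction (`VortexSociety.no_model_on_ring`), as a pair is a separation of order at
  most four and a triangle meets at most six branch sets.
* Otherwise `p ≥ 3`, or `p = q = 2`. Then a few legs and branch sets off the ring form planar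
  connections between ring vertices. There are too few gates for the branch sets that would have to
  pass them, or else one of the forbidden planar minors arises
  (`BicliqueModel.false_of_three_three`, `false_of_three_two`, `false_of_three_one`,
  `false_of_two_zero` and `false_of_two_two`).
-/

/-! ### Connected sets and minors -/

/-- `ReachIn G T a b`: some walk of `G` from `a` to `b` stays inside `T`. -/
def ReachIn {V : Type*} (G : SimpleGraph V) (T : Set V) (a b : V) : Prop :=
  ∃ p : G.Walk a b, ∀ v ∈ p.support, v ∈ T

/-- `ConnIn G T`: the subgraph of `G` induced by `T` is connected or empty. -/
def ConnIn {V : Type*} (G : SimpleGraph V) (T : Set V) : Prop :=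
  ∀ a ∈ T, ∀ b ∈ T, ReachIn G T a b

section Reach

variable {V : Type*} {G : SimpleGraph V} {S T : Set V} {a b c : V}

theorem ReachIn.refl (ha : a ∈ T) : ReachIn G T a a :=
  ⟨.nil, by simpa using ha⟩

theorem ReachIn.symm (h : ReachIn G T a b) : ReachIn G T b a := by
  obtain ⟨p, hp⟩ := h
  exact ⟨p.reverse, by simpa using hp⟩

theorem ReachIn.trans (h : ReachIn G T a b) (h' : ReachIn G T b c) : ReachIn G T a c := by
  obtain ⟨p, hp⟩ := h
  obtain ⟨q, hq⟩ := h'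
  refine ⟨p.append q, fun v hv => ?_⟩
  rcases SimpleGraph.Walk.mem_support_append_iff _ _ |>.1 hv with h | h
  exacts [hp v h, hq v h]

theorem ReachIn.mono (h : ReachIn G S a b) (hST : S ⊆ T) : ReachIn G T a b := by
  obtain ⟨p, hp⟩ := h
  exact ⟨p, fun v hv => hST (hp v hv)⟩

theorem ReachIn.of_adj (h : G.Adj a b) (ha : a ∈ T) (hb : b ∈ T) : ReachIn G T a b :=
  ⟨.cons h .nil, by simp [ha, hb]⟩

theorem ReachIn.left_mem (h : ReachIn G T a b) : a ∈ T := by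
  obtain ⟨p, hp⟩ := h
  exact hp _ p.start_mem_support

theorem ReachIn.right_mem (h : ReachIn G T a b) : b ∈ T := by
  obtain ⟨p, hp⟩ := h
  exact hp _ p.end_mem_support

theorem ConnIn.union (hS : ConnIn G S) (hT : ConnIn G T)
    (h : ∃ u ∈ S, ∃ v ∈ T, ReachIn G (S ∪ T) u v) : ConnIn G (S ∪ T) := by
  obtain ⟨u, hu, v, hv, huv⟩ := h
  have key : ∀ a ∈ S ∪ T, ReachIn G (S ∪ T) a u := by
    rintro a (ha | ha)
    · exact (hS a ha u hu).mono Set.subset_union_left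
    · exact ((hT a ha v hv).mono Set.subset_union_right).trans huv.symm
  exact fun a ha b hb => (key a ha).trans (key b hb).symm

theorem ConnIn.union_of_adj (hS : ConnIn G S) (hT : ConnIn G T)
    (h : ∃ u ∈ S, ∃ v ∈ T, G.Adj u v) : ConnIn G (S ∪ T) := by
  obtain ⟨u, hu, v, hv, huv⟩ := h
  exact hS.union hT ⟨u, hu, v, hv, .of_adj huv (.inl hu) (.inr hv)⟩

theorem ConnIn.union_of_mem (hS : ConnIn G S) (hT : ConnIn G T)
    (h : (S ∩ T).Nonempty) : ConnIn G (S ∪ T) := by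
  obtain ⟨u, hu, hv⟩ := h
  exact hS.union hT ⟨u, hu, u, hv, .refl (.inl hu)⟩

theorem connIn_setOf_reachIn : ConnIn G {u | ReachIn G T a u} := by
  classical
  have key : ∀ u, ReachIn G T a u → ReachIn G {u | ReachIn G T a u} a u := by
    rintro u ⟨p, hp⟩
    refine ⟨p, fun v hv => ⟨p.takeUntil v hv, fun w hw => hp w ?_⟩⟩
    exact p.support_takeUntil_subset_support hv hw
  exact fun u hu v hv => (key u hu).symm.trans (key v hv)

theorem connIn_support {a b : V} (p : G.Walk a b) : ConnIn G {v | v ∈ p.support} := by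
  classical
  have key : ∀ u ∈ p.support, ReachIn G {v | v ∈ p.support} a u := fun u hu =>
    ⟨p.takeUntil u hu, fun w hw => p.support_takeUntil_subset_support hu hw⟩
  exact fun u hu v hv => (key u hu).symm.trans (key v hv)

end Reach

/-- `H` is a (not necessarily matching) minor of `G`: there are nonempty, connected, pairwise
disjoint branch sets in `G`, one for each vertex of `H`, such that the branch sets of adjacent
vertices are joined by an edge. -/
def HasMinor {W V : Type*} (H : SimpleGraph W) (G : SimpleGraph V) : Prop :=
  ∃ T : W → Set V, (∀ w, (T w).Nonempty) ∧ (∀ w, ConnIn G (T w)) ∧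
    (∀ w w', w ≠ w' → Disjoint (T w) (T w')) ∧
    ∀ w w', H.Adj w w' → ∃ u ∈ T w, ∃ v ∈ T w', G.Adj u v

section Minor

variable {U V W : Type*}

/-- Pulling back a connected set along a map with connected fibres that lifts edges. -/
theorem ConnIn.biUnion {G : SimpleGraph V} {H : SimpleGraph W} {S : W → Set V}
    (hS : ∀ w, ConnIn G (S w))
    (hadj : ∀ w w', H.Adj w w' → ∃ u ∈ S w, ∃ v ∈ S w', G.Adj u v)
    {T : Set W} (hT : ConnIn H T) : ConnIn G (⋃ w ∈ T, S w) := by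
  have key : ∀ {w w' : W} (p : H.Walk w w'), (∀ z ∈ p.support, z ∈ T) →
      ∀ u ∈ S w, ∀ v ∈ S w', ReachIn G (⋃ w ∈ T, S w) u v := by
    intro w w' p
    induction p with
    | nil =>
      intro hp u hu v hv
      exact (hS _ u hu v hv).mono (Set.subset_biUnion_of_mem (u := S) (hp _ (by simp)))
    | @cons w x w' h p ih =>
      intro hp u hu v hv
      have hw : w ∈ T := hp _ (by simp)
      have hx : x ∈ T := hp _ (by simp)
      obtain ⟨a, ha, b, hb, hab⟩ := hadj _ _ h
      refine ((hS _ u hu a ha).mono (Set.subset_biUnion_of_mem (u := S) hw)).trans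
        ((ReachIn.of_adj hab (Set.mem_biUnion hw ha) (Set.mem_biUnion hx hb)).trans
          (ih (fun z hz => hp z (by simp [hz])) b hb v hv))
  intro a ha b hb
  obtain ⟨w, hw, ha⟩ := Set.mem_iUnion₂.1 ha
  obtain ⟨w', hw', hb⟩ := Set.mem_iUnion₂.1 hb
  obtain ⟨p, hp⟩ := hT w hw w' hw'
  exact key p hp a ha b hb

theorem HasMinor.trans {H : SimpleGraph U} {K : SimpleGraph W} {G : SimpleGraph V}
    (hHK : HasMinor H K) (hKG : HasMinor K G) : HasMinor H G := by
  obtain ⟨T, hT, hTc, hTd, hTa⟩ := hHK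
  obtain ⟨S, hS, hSc, hSd, hSa⟩ := hKG
  refine ⟨fun u => ⋃ w ∈ T u, S w, fun u => ?_, fun u => (hTc u).biUnion hSc hSa, ?_, ?_⟩
  · obtain ⟨w, hw⟩ := hT u
    obtain ⟨v, hv⟩ := hS w
    exact ⟨v, Set.mem_biUnion hw hv⟩
  · intro u u' huu'
    simp only [Set.disjoint_iUnion_left, Set.disjoint_iUnion_right]
    intro w hw w' hw'
    exact hSd _ _ (fun h => Set.disjoint_left.1 (hTd u u' huu') hw' (h ▸ hw))
  · intro u u' h
    obtain ⟨w, hw, w', hw', hww'⟩ := hTa u u' h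
    obtain ⟨a, ha, b, hb, hab⟩ := hSa w w' hww'
    exact ⟨a, Set.mem_biUnion hw ha, b, Set.mem_biUnion hw' hb, hab⟩

/-- An injective homomorphism exhibits its source as a minor of its target. -/
theorem HasMinor.of_hom {H : SimpleGraph W} {G : SimpleGraph V} (f : H →g G)
    (hf : Function.Injective f) : HasMinor H G :=
  ⟨fun w => {f w}, fun w => ⟨_, rfl⟩, by
      rintro w _ rfl _ rfl
      exact .refl rfl,
    fun w w' h => by simpa using fun h' => h (hf h'),
    fun w w' h => ⟨_, rfl, _, rfl, f.map_adj h⟩⟩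

theorem IsBicontraction.hasMinor {G : SimpleGraph V} {H : SimpleGraph W}
    (h : IsBicontraction G H) : HasMinor H G := by
  obtain ⟨v, u₀, u₁, -, hv, f, hf, hff, hH⟩ := h
  have h₀ : G.Adj v u₀ := by
    have : u₀ ∈ G.neighborSet v := by simp [hv]
    exact this
  have h₁ : G.Adj v u₁ := by
    have : u₁ ∈ G.neighborSet v := by simp [hv]
    exact this
  refine ⟨fun w => f ⁻¹' {w}, fun w => ?_, ?_, ?_, ?_⟩
  · obtain ⟨a, ha⟩ := hf w
    exact ⟨a, ha⟩
  · intro w a ha b hb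
    rcases (hff a b).1 (by rw [show f a = w from ha, show f b = w from hb]) with rfl | ⟨ha', hb'⟩
    · exact .refl ha
    · -- both vertices lie in the contracted star with centre `v`
      have hvw : f v = w := by
        rw [← show f a = w from ha]
        exact (hff v a).2 (.inr ⟨by simp, ha'⟩)
      have key : ∀ c, c ∈ ({v, u₀, u₁} : Set V) → f c = w → ReachIn G (f ⁻¹' {w}) v c := by
        rintro c (rfl | rfl | rfl) hc
        exacts [.refl hc, .of_adj h₀ hvw hc, .of_adj h₁ hvw hc]
      exact (key a ha' ha).symm.trans (key b hb' hb)
  · intro w w' hww'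
    rw [Set.disjoint_left]
    intro a (ha : f a = w) (hb : f a = w')
    exact hww' (ha.symm.trans hb)
  · intro w w' h
    obtain ⟨-, a, b, ha, hb, hab⟩ := (hH w w').1 h
    exact ⟨a, ha, b, hb, hab⟩

theorem BicontractsTo.hasMinor {H : SimpleGraph W} {G : SimpleGraph V}
    (h : BicontractsTo H G) : HasMinor H G := by
  induction h with
  | iso G e => exact .of_hom e.symm.toHom e.symm.injective
  | step G G' h _ ih => exact ih.trans h.hasMinor

theorem IsMatchingMinor.hasMinor {H : SimpleGraph W} {G : SimpleGraph V}
    (h : IsMatchingMinor H G) : HasMinor H G := by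
  obtain ⟨S, -, hS⟩ := h
  exact hS.hasMinor.trans (.of_hom S.hom S.hom_injective)

theorem IsBicontraction.card_eq {G : SimpleGraph V} {H : SimpleGraph W} [Finite V]
    (h : IsBicontraction G H) : Nat.card V = Nat.card W + 2 := by
  classical
  obtain ⟨v, u₀, u₁, hu, hv, f, hf, hff, hH⟩ := h
  have h₀ : v ≠ u₀ := by
    have : u₀ ∈ G.neighborSet v := by simp [hv]
    exact G.ne_of_adj this
  have h₁ : v ≠ u₁ := by
    have : u₁ ∈ G.neighborSet v := by simp [hv]
    exact G.ne_of_adj this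
  have : Finite W := Finite.of_surjective f hf
  -- `f` restricts to a bijection from the complement of the two contracted neighbours
  have hbij : Set.BijOn f ({u₀, u₁} : Set V)ᶜ Set.univ := by
    refine ⟨fun _ _ => trivial, ?_, ?_⟩
    · intro a ha b hb hab
      simp only [Set.mem_compl_iff, Set.mem_insert_iff, Set.mem_singleton_iff, not_or] at ha hb
      rcases (hff a b).1 hab with h | ⟨h, h'⟩
      · exact h
      · simp_all
    · intro w _
      obtain ⟨a, rfl⟩ := hf w
      by_cases ha : a ∈ ({u₀, u₁} : Set V)
      · refine ⟨v, by simp [h₀, h₁], (hff v a).2 (.inr ⟨by simp, ?_⟩)⟩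
        exact Set.mem_insert_of_mem _ ha
      · exact ⟨a, ha, rfl⟩
  have h1 : Nat.card W = (({u₀, u₁} : Set V)ᶜ).ncard := by
    rw [← Set.ncard_univ, ← hbij.image_eq, hbij.injOn.ncard_image]
  have h2 := Set.ncard_add_ncard_compl ({u₀, u₁} : Set V)
  rw [Set.ncard_pair hu] at h2
  omega

theorem BicontractsTo.card_mod_two {H : SimpleGraph W} {G : SimpleGraph V} [hV : Finite V]
    (h : BicontractsTo H G) : Nat.card V % 2 = Nat.card W % 2 := by
  revert hV
  induction h with
  | iso G e => intro _; rw [Nat.card_congr e.toEquiv]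
  | @step V V' G G' h _ ih =>
    intro hV
    obtain ⟨v, u₀, u₁, hu, hv, f, hf, hff, hH⟩ := id h
    have : Finite V' := Finite.of_surjective f hf
    rw [h.card_eq, Nat.add_mod_right]
    exact ih

theorem SimpleGraph.Subgraph.IsPerfectMatching.natCard_even {G : SimpleGraph V} [Finite V]
    {M : G.Subgraph} (hM : M.IsPerfectMatching) : Even (Nat.card V) := by
  classical
  have := Fintype.ofFinite V
  rw [Nat.card_eq_fintype_card]
  exact hM.even_card

/-- Conformality and bicontractions preserve the parity of the number of vertices. -/
theorem IsMatchingMinor.card_mod_two {H : SimpleGraph W} {G : SimpleGraph V} [Finite V]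
    (h : IsMatchingMinor H G) : Nat.card V % 2 = Nat.card W % 2 := by
  obtain ⟨S, ⟨M, hM⟩, hS⟩ := h
  have h1 := hM.natCard_even
  have h2 := hS.card_mod_two
  have h3 := Set.ncard_add_ncard_compl S.verts
  rw [← Nat.card_coe_set_eq, ← Nat.card_coe_set_eq] at h3
  obtain ⟨m, hm⟩ := h1
  omega

end Minor

/-! ### Drawings in a half-plane, modulo two -/

/-- A *vortex society*: a graph `graph` made of a spanning planar graph `planar`, drawn in a
half-plane with the vertices of `ring` on the boundary line (in the order given by `pos`), and of
further edges, the chords, each of which joins two ring vertices.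

The drawing is recorded modulo two. `left u v` says whether `v` lies to the left of `u`, and `cross
v u u'` is the parity of the number of times that the edge `uu'` crosses the upward vertical ray
from `v`; the downward ray is then crossed `cross v u u' + left v u + left v u'` times. The axiom
`crossing` expresses that two disjoint planar edges do not cross, and `ring_cross` that nothing is
drawn below the boundary line.

Every ring vertex `x` is passed over by the chords at a single vertex `gate x` only: a chord that
avoids `x`, `y`, `gate x` and `gate y` does not join the two sides of the pair `x`, `y`. -/
structure VortexSociety (V : Type*) where
  graph : SimpleGraph V
  planar : SimpleGraph V
  planar_le : planar ≤ graph
  ring : Set V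
  pos : V → ℕ
  pos_injOn : Set.InjOn pos ring
  gate : V → V
  left : V → V → ZMod 2
  cross : V → V → V → ZMod 2
  left_add : ∀ u v, u ≠ v → left u v + left v u = 1
  left_ring : ∀ u ∈ ring, ∀ v ∈ ring, left u v = if pos v < pos u then 1 else 0
  crossing : ∀ u u' x x', planar.Adj u u' → planar.Adj x x' →
    u ≠ x → u ≠ x' → u' ≠ x → u' ≠ x' →
    (cross u x x' + cross u' x x') + (cross x u u' + cross x' u u') +
      (left x u + left x u') + (left x' u + left x' u') = 0
  ring_cross : ∀ v ∈ ring, ∀ u u', planar.Adj u u' → v ≠ u → v ≠ u' →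
    cross v u u' = left v u + left v u'
  chord : ∀ u v, graph.Adj u v → ¬ planar.Adj u v → u ∈ ring ∧ v ∈ ring ∧
    ∀ x ∈ ring, ∀ y ∈ ring, u ≠ x → u ≠ y → v ≠ x → v ≠ y →
      gate x ≠ u → gate x ≠ v → gate y ≠ u → gate y ≠ v →
      ((pos x < pos u ∧ pos u < pos y ∨ pos y < pos u ∧ pos u < pos x) ↔
        (pos x < pos v ∧ pos v < pos y ∨ pos y < pos v ∧ pos v < pos x))

namespace VortexSociety

variable {V : Type*} (N : VortexSociety V)

/-- `N.Inside x y p`: in the linear order of the ring, `p` lies strictly between `x` and `y`. -/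
def Inside (x y p : V) : Prop :=
  N.pos x < N.pos p ∧ N.pos p < N.pos y ∨ N.pos y < N.pos p ∧ N.pos p < N.pos x

/-- The parity of the number of crossings of a walk with the upward ray from `v`. -/
def walkCross {G : SimpleGraph V} (v : V) : ∀ {a b : V}, G.Walk a b → ZMod 2
  | _, _, .nil => 0
  | _, _, .cons (u := u) (v := u') _ p => N.cross v u u' + walkCross v p

variable {N}

theorem walkCross_of_mem_ring {v : V} (hv : v ∈ N.ring) {a b : V} (p : N.planar.Walk a b)
    (hp : v ∉ p.support) : N.walkCross v p = N.left v a + N.left v b := by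
  induction p with
  | nil => simp [walkCross, CharTwo.add_self_eq_zero]
  | @cons a a' b h p ih =>
    simp only [SimpleGraph.Walk.support_cons, List.mem_cons, not_or] at hp
    have h1 : v ≠ a' := fun h => hp.2 (h ▸ p.start_mem_support)
    rw [walkCross, ih hp.2, N.ring_cross v hv a a' h hp.1 h1]
    linear_combination CharTwo.add_self_eq_zero (N.left v a')

theorem edge_walk_crossing {u u' : V} (h : N.planar.Adj u u') {c d : V} (q : N.planar.Walk c d)
    (hu : u ∉ q.support) (hu' : u' ∉ q.support) :
    N.walkCross u q + N.walkCross u' q + (N.cross c u u' + N.cross d u u') +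
      (N.left c u + N.left c u') + (N.left d u + N.left d u') = 0 := by
  induction q with
  | @nil c =>
    simp only [walkCross]
    linear_combination CharTwo.add_self_eq_zero (N.cross c u u') +
      CharTwo.add_self_eq_zero (N.left c u + N.left c u')
  | @cons c c' d h' q ih =>
    simp only [SimpleGraph.Walk.support_cons, List.mem_cons, not_or] at hu hu'
    have e1 : u ≠ c' := fun e => hu.2 (e ▸ q.start_mem_support)
    have e2 : u' ≠ c' := fun e => hu'.2 (e ▸ q.start_mem_support)
    have := N.crossing u u' c c' h h' hu.1 e1 hu'.1 e2
    simp only [walkCross]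
    linear_combination ih hu.2 hu'.2 + this - CharTwo.add_self_eq_zero (N.cross c' u u') -
      CharTwo.add_self_eq_zero (N.left c' u + N.left c' u')

/-- Two disjoint walks of the planar graph cross an even number of times. -/
theorem walk_crossing {a b c d : V} (p : N.planar.Walk a b) (q : N.planar.Walk c d)
    (hpq : ∀ v ∈ p.support, v ∉ q.support) :
    N.walkCross a q + N.walkCross b q + (N.walkCross c p + N.walkCross d p) +
      (N.left c a + N.left c b) + (N.left d a + N.left d b) = 0 := by
  induction p with
  | @nil a =>
    simp only [walkCross]
    linear_combination CharTwo.add_self_eq_zero (N.walkCross a q) +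
      CharTwo.add_self_eq_zero (N.left c a + N.left d a)
  | @cons a a' b h p ih =>
    simp only [SimpleGraph.Walk.support_cons, List.mem_cons, forall_eq_or_imp] at hpq
    have := edge_walk_crossing h q hpq.1 (hpq.2 _ p.start_mem_support)
    simp only [walkCross]
    linear_combination ih hpq.2 + this - CharTwo.add_self_eq_zero (N.walkCross a' q) -
      CharTwo.add_self_eq_zero (N.left c a' + N.left d a')

/-- Disjoint planar connections between ring vertices do not interleave. -/
theorem noncrossing {B T : Set V} (hBT : Disjoint B T) {x y p q : V}
    (hxy : ReachIn N.planar B x y) (hpq : ReachIn N.planar T p q)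
    (hx : x ∈ N.ring) (hy : y ∈ N.ring) (hp : p ∈ N.ring) (hq : q ∈ N.ring) :
    N.Inside x y p ↔ N.Inside x y q := by
  have ne : ∀ {u v}, u ∈ B → v ∈ T → u ∈ N.ring → v ∈ N.ring → N.pos u ≠ N.pos v :=
    fun hu hv hu' hv' h =>
      Set.disjoint_left.1 hBT hu ((N.pos_injOn hu' hv' h) ▸ hv)
  have h1 := ne hxy.left_mem hpq.left_mem hx hp
  have h2 := ne hxy.left_mem hpq.right_mem hx hq
  have h3 := ne hxy.right_mem hpq.left_mem hy hp
  have h4 := ne hxy.right_mem hpq.right_mem hy hq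
  obtain ⟨P, hP⟩ := hxy
  obtain ⟨Q, hQ⟩ := hpq
  have hd : ∀ v ∈ P.support, v ∉ Q.support := fun v hv hv' =>
    Set.disjoint_left.1 hBT (hP v hv) (hQ v hv')
  have key := walk_crossing P Q hd
  rw [walkCross_of_mem_ring hx Q (hd _ P.start_mem_support),
    walkCross_of_mem_ring hy Q (hd _ P.end_mem_support),
    walkCross_of_mem_ring hp P (fun h => hd _ h Q.start_mem_support),
    walkCross_of_mem_ring hq P (fun h => hd _ h Q.end_mem_support)] at key
  simp only [N.left_ring, hx, hy, hp, hq] at key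
  unfold Inside
  have k2 : (1 + 1 : ZMod 2) = 0 := by decide
  have k3 : (1 : ZMod 2) ≠ 0 := by decide
  rcases lt_or_gt_of_ne h1 with a1 | a1 <;> rcases lt_or_gt_of_ne h2 with a2 | a2 <;>
  rcases lt_or_gt_of_ne h3 with a3 | a3 <;> rcases lt_or_gt_of_ne h4 with a4 | a4 <;>
  simp [a1, a2, a3, a4, a1.not_gt, a2.not_gt, a3.not_gt, a4.not_gt, k2] at key ⊢

/-- The planar graph has no outer `K_{2,3}`: three disjoint connected sets that meet the boundary
cannot all be attached to two further connected sets. -/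
theorem no_planar_K23 {A : Fin 2 → Set V} {B : Fin 3 → Set V} {π : Fin 3 → V}
    (hA : ∀ i, ConnIn N.planar (A i)) (hB : ∀ j, ConnIn N.planar (B j))
    (hAA : Disjoint (A 0) (A 1)) (hBB : ∀ j j', j ≠ j' → Disjoint (B j) (B j'))
    (hAB : ∀ i j, Disjoint (A i) (B j)) (hπ : ∀ j, π j ∈ B j) (hr : ∀ j, π j ∈ N.ring)
    (hadj : ∀ i j, ∃ u ∈ A i, ∃ v ∈ B j, N.planar.Adj u v) : False := by
  have hne : ∀ i, ∃ a, a ∈ A i := fun i => (hadj i 0).imp fun _ h => h.1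
  choose a ha using hne
  have hP : ∀ i j, ReachIn N.planar (A i ∪ B j) (a i) (π j) := fun i j =>
    (hA i).union_of_adj (hB j) (hadj i j) _ (.inl (ha i)) _ (.inr (hπ j))
  choose P hP using hP
  have hd : ∀ j j', j ≠ j' → ∀ v ∈ (P 0 j).support, v ∉ (P 1 j').support := by
    intro j j' hj v hv hv'
    have : Disjoint (A 0 ∪ B j) (A 1 ∪ B j') := by
      simp only [Set.disjoint_union_left, Set.disjoint_union_right]
      exact ⟨⟨hAA, (hAB _ _).symm⟩, hAB _ _, hBB _ _ hj⟩
    exact Set.disjoint_left.1 this (hP _ _ v hv) (hP _ _ v hv')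
  have key : ∀ j j', j ≠ j' → N.walkCross (a 0) (P 1 j') + N.walkCross (a 1) (P 0 j) +
      N.left (a 1) (a 0) + 1 + N.left (π j) (π j') = 0 := by
    intro j j' hj
    have h1 := walk_crossing (P 0 j) (P 1 j') (hd j j' hj)
    rw [walkCross_of_mem_ring (hr j) _ (hd j j' hj _ (P 0 j).end_mem_support),
      walkCross_of_mem_ring (hr j') _ (fun h => hd j j' hj _ h (P 1 j').end_mem_support)] at h1
    have h2 := N.left_add (a 1) (π j) (fun h => Set.disjoint_left.1 (hAB 1 j) (ha 1) (h ▸ hπ j))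
    linear_combination h1 - h2 - CharTwo.add_self_eq_zero (N.left (π j') (a 0)) -
      CharTwo.add_self_eq_zero (N.left (π j') (π j))
  have hs : ∀ j j', j ≠ j' → N.left (π j) (π j') + N.left (π j') (π j) = 1 := fun j j' hj =>
    N.left_add _ _ fun h => Set.disjoint_left.1 (hBB j j' hj) (hπ j) (h ▸ hπ j')
  have k01 := key 0 1 (by decide)
  have k10 := key 1 0 (by decide)
  have k02 := key 0 2 (by decide)
  have k20 := key 2 0 (by decide)
  have k12 := key 1 2 (by decide)
  have k21 := key 2 1 (by decide)
  have s01 := hs 0 1 (by decide)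
  have s02 := hs 0 2 (by decide)
  have s12 := hs 1 2 (by decide)
  have : (1 : ZMod 2) = 0 := by
    grind
  exact absurd this (by decide)

/-- `K_{3,3}` is not a minor of the planar graph. -/
theorem no_planar_K33 {A B : Fin 3 → Set V}
    (hA : ∀ i, ConnIn N.planar (A i)) (hB : ∀ j, ConnIn N.planar (B j))
    (hAA : ∀ i i', i ≠ i' → Disjoint (A i) (A i')) (hBB : ∀ j j', j ≠ j' → Disjoint (B j) (B j'))
    (hAB : ∀ i j, Disjoint (A i) (B j))
    (hadj : ∀ i j, ∃ u ∈ A i, ∃ v ∈ B j, N.planar.Adj u v) : False := by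
  have hne : ∀ i, ∃ a, a ∈ A i := fun i => (hadj i 0).imp fun _ h => h.1
  have hne' : ∀ j, ∃ b, b ∈ B j := fun j =>
    let ⟨_, _, v, hv, _⟩ := hadj 0 j
    ⟨v, hv⟩
  choose a ha using hne
  choose b hb using hne'
  have hP : ∀ i j, ReachIn N.planar (A i ∪ B j) (a i) (b j) := fun i j =>
    (hA i).union_of_adj (hB j) (hadj i j) _ (.inl (ha i)) _ (.inr (hb j))
  choose P hP using hP
  have key : ∀ i i', i ≠ i' → ∀ j j', j ≠ j' →
      N.walkCross (a i) (P i' j') + N.walkCross (b j) (P i' j') +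
      (N.walkCross (a i') (P i j) + N.walkCross (b j') (P i j)) +
      (N.left (a i') (a i) + N.left (a i') (b j)) +
      (N.left (b j') (a i) + N.left (b j') (b j)) = 0 := by
    intro i i' hi j j' hj
    refine walk_crossing (P i j) (P i' j') fun v hv hv' => ?_
    have : Disjoint (A i ∪ B j) (A i' ∪ B j') := by
      simp only [Set.disjoint_union_left, Set.disjoint_union_right]
      exact ⟨⟨hAA _ _ hi, (hAB _ _).symm⟩, hAB _ _, hBB _ _ hj⟩
    exact Set.disjoint_left.1 this (hP _ _ v hv) (hP _ _ v hv')
  have hs : ∀ j j', j ≠ j' → N.left (b j) (b j') + N.left (b j') (b j) = 1 := fun j j' hj =>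
    N.left_add _ _ fun h => Set.disjoint_left.1 (hBB j j' hj) (hb j) (h ▸ hb j')
  have ht : ∀ i j, N.left (a i) (b j) + N.left (b j) (a i) = 1 := fun i j =>
    N.left_add _ _ fun h => Set.disjoint_left.1 (hAB i j) (ha i) (h ▸ hb j)
  have k0101 := key 0 1 (by decide) 0 1 (by decide)
  have k0102 := key 0 1 (by decide) 0 2 (by decide)
  have k0110 := key 0 1 (by decide) 1 0 (by decide)
  have k0112 := key 0 1 (by decide) 1 2 (by decide)
  have k0120 := key 0 1 (by decide) 2 0 (by decide)
  have k0121 := key 0 1 (by decide) 2 1 (by decide)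
  have k0201 := key 0 2 (by decide) 0 1 (by decide)
  have k0202 := key 0 2 (by decide) 0 2 (by decide)
  have k0210 := key 0 2 (by decide) 1 0 (by decide)
  have k0212 := key 0 2 (by decide) 1 2 (by decide)
  have k0220 := key 0 2 (by decide) 2 0 (by decide)
  have k0221 := key 0 2 (by decide) 2 1 (by decide)
  have k1201 := key 1 2 (by decide) 0 1 (by decide)
  have k1202 := key 1 2 (by decide) 0 2 (by decide)
  have k1210 := key 1 2 (by decide) 1 0 (by decide)
  have k1212 := key 1 2 (by decide) 1 2 (by decide)
  have k1220 := key 1 2 (by decide) 2 0 (by decide)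
  have k1221 := key 1 2 (by decide) 2 1 (by decide)
  have s01 := hs 0 1 (by decide)
  have s02 := hs 0 2 (by decide)
  have s12 := hs 1 2 (by decide)
  clear key hs ht
  have : (1 : ZMod 2) = 0 := by
    grind
  exact absurd this (by decide)

end VortexSociety

/-! ### Separations of the ring, and minors all of whose branch sets meet it -/

namespace VortexSociety

variable {V : Type*} {N : VortexSociety V}

/-- If the planar parts of a set `T` respect the two sides of the pair `x`, `y`, then so does `T`
itself, provided that it contains none of `x`, `y` and their gates. -/
theorem inside_iff_of_planar {T : Set V} (hT : ConnIn N.graph T) {x y : V} (hx : x ∈ N.ring)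
    (hy : y ∈ N.ring) (hxT : x ∉ T) (hyT : y ∉ T) (hx' : N.gate x ∉ T) (hy' : N.gate y ∉ T)
    (h : ∀ p ∈ N.ring, ∀ q ∈ N.ring, ReachIn N.planar T p q → (N.Inside x y p ↔ N.Inside x y q))
    {p q : V} (hp : p ∈ N.ring) (hq : q ∈ N.ring) (hpT : p ∈ T) (hqT : q ∈ T) :
    N.Inside x y p ↔ N.Inside x y q := by
  have key : ∀ {u v : V} (w : N.graph.Walk u v), (∀ z ∈ w.support, z ∈ T) →
      ∀ p ∈ N.ring, ∀ q ∈ N.ring, ReachIn N.planar T p u → ReachIn N.planar T v q →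
        (N.Inside x y p ↔ N.Inside x y q) := by
    intro u v w
    induction w with
    | nil => exact fun _ p hp q hq h1 h2 => h p hp q hq (h1.trans h2)
    | @cons u u' v huu' w ih =>
      intro hw p hp q hq h1 h2
      have hu : u ∈ T := hw _ (by simp)
      have hu' : u' ∈ T := hw _ (by simp)
      have hw' : ∀ z ∈ w.support, z ∈ T := fun z hz => hw z (by simp [hz])
      by_cases hpl : N.planar.Adj u u'
      · exact ih hw' p hp q hq (h1.trans (.of_adj hpl hu hu')) h2
      · obtain ⟨hur, hur', hc⟩ := N.chord u u' huu' hpl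
        have ne : ∀ {a b : V}, a ∈ T → b ∉ T → a ≠ b := fun ha hb hab => hb (hab ▸ ha)
        exact (h p hp u hur h1).trans ((hc x hx y hy (ne hu hxT) (ne hu hyT) (ne hu' hxT)
          (ne hu' hyT) (ne hu hx').symm (ne hu' hx').symm (ne hu hy').symm (ne hu' hy').symm).trans
          (ih hw' u' hur' q hq (.refl hu') h2))
  obtain ⟨w, hw⟩ := hT p hpT q hqT
  exact key w hw p hp q hq (.refl hpT) (.refl hqT)

/-- A planar connection `B` between `x` and `y` separates: a connected set disjoint from `B` can
reach both sides of the pair `x`, `y` only through `gate x` or `gate y`. -/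
theorem inside_iff_of_barrier {B T : Set V} (hT : ConnIn N.graph T) (hBT : Disjoint B T) {x y : V}
    (hB : ReachIn N.planar B x y) (hx : x ∈ N.ring) (hy : y ∈ N.ring)
    (hx' : N.gate x ∉ T) (hy' : N.gate y ∉ T)
    {p q : V} (hp : p ∈ N.ring) (hq : q ∈ N.ring) (hpT : p ∈ T) (hqT : q ∈ T) :
    N.Inside x y p ↔ N.Inside x y q :=
  inside_iff_of_planar hT hx hy (Set.disjoint_left.1 hBT hB.left_mem)
    (Set.disjoint_left.1 hBT hB.right_mem) hx' hy'
    (fun _ hp _ hq h => noncrossing hBT hB h hx hy hp hq) hp hq hpT hqT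

theorem planar_adj_of_notMem_ring {u v : V} (h : N.graph.Adj u v) (hu : u ∉ N.ring) :
    N.planar.Adj u v := by
  by_contra hpl
  exact hu (N.chord u v h hpl).1

/-- Inside a connected set that meets the ring, every vertex has a planar connection to the ring. -/
theorem exists_reachIn_ring {T : Set V} (hT : ConnIn N.graph T) {r : V} (hr : r ∈ N.ring)
    (hrT : r ∈ T) {c : V} (hc : c ∈ T) : ∃ t ∈ N.ring, ReachIn N.planar T c t := by
  obtain ⟨w, hw⟩ := hT c hc r hrT
  induction w with
  | nil => exact ⟨_, hr, .refl hrT⟩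
  | @cons c c' r h w ih =>
    by_cases hcr : c ∈ N.ring
    · exact ⟨c, hcr, .refl hc⟩
    · have hc' : c' ∈ T := hw _ (by simp)
      obtain ⟨t, ht, ht'⟩ := ih hr hrT hc' (fun z hz => hw z (by simp [hz]))
      exact ⟨t, ht, (ReachIn.of_adj (planar_adj_of_notMem_ring h hcr) hc hc').trans ht'⟩

theorem connIn_planar_of_disjoint_ring {X : Set V} (hX : ConnIn N.graph X)
    (hd : Disjoint X N.ring) : ConnIn N.planar X := by
  intro a ha b hb
  obtain ⟨w, hw⟩ := hX a ha b hb
  induction w with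
  | nil => exact .refl ha
  | @cons c c' r h w ih =>
    have hc' : c' ∈ X := hw _ (by simp)
    exact (ReachIn.of_adj (planar_adj_of_notMem_ring h (Set.disjoint_left.1 hd ha)) ha hc').trans
      (ih hc' hb (fun z hz => hw z (by simp [hz])))

/-- `N.IsLeg X T L t`: inside `T`, the planar connected set `L` joins a neighbour of `X` to the ring
vertex `t`. -/
structure IsLeg (N : VortexSociety V) (X T L : Set V) (t : V) : Prop where
  subset : L ⊆ T
  conn : ConnIn N.planar L
  mem : t ∈ L
  mem_ring : t ∈ N.ring
  adj : ∃ u ∈ X, ∃ v ∈ L, N.planar.Adj u v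

/-- A set off the ring is joined to each adjacent connected set that meets the ring by a leg. -/
theorem exists_isLeg {X T : Set V} (hX : Disjoint X N.ring) (hT : ConnIn N.graph T)
    (hTr : (T ∩ N.ring).Nonempty) (hadj : ∃ u ∈ X, ∃ v ∈ T, N.graph.Adj u v) :
    ∃ L t, N.IsLeg X T L t := by
  obtain ⟨r, hrT, hr⟩ := hTr
  obtain ⟨u, hu, v, hv, huv⟩ := hadj
  obtain ⟨t, ht, w, hw⟩ := exists_reachIn_ring hT hr hrT hv
  exact ⟨{z | z ∈ w.support}, t, hw, connIn_support w, w.end_mem_support, ht, u, hu, v,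
    w.start_mem_support, planar_adj_of_notMem_ring huv (Set.disjoint_left.1 hX hu)⟩

section AllOnRing

variable {ι : Type*} (U : ι → Set V)

/-- The planar component of `v` in the member of the family `U` that contains `v`; a vertex outside
all members is a component of its own. -/
def piece (N : VortexSociety V) (v : V) : Set V :=
  {u | u = v ∨ ∃ i, ReachIn N.planar (U i) v u}

/-- No planar connected subset of the union of two members of `U`, disjoint from the components of
`x` and `y`, meets the ring on both sides of the pair `x`, `y`. -/
def SeparatesPieces (N : VortexSociety V) (x y : V) : Prop :=
  ∀ i j (D : Set V), D ⊆ U i ∪ U j → ConnIn N.planar D → Disjoint (piece U N x) D →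
    Disjoint (piece U N y) D → ∀ p ∈ D, p ∈ N.ring → ∀ q ∈ D, q ∈ N.ring →
      (N.Inside x y p ↔ N.Inside x y q)

/-- `x` and `p` lie in the same component or in adjacent components. -/
def Linked (N : VortexSociety V) (x p : V) : Prop :=
  ∃ D : Set V, D ⊆ piece U N x ∪ piece U N p ∧ ConnIn N.planar D ∧ x ∈ D ∧ p ∈ D

variable {U}

theorem mem_piece_self (v : V) : v ∈ piece U N v := .inl rfl

theorem connIn_piece (v : V) : ConnIn N.planar (piece U N v) := by
  have key : ∀ u ∈ piece U N v, ReachIn N.planar (piece U N v) v u := by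
    rintro u (rfl | ⟨i, hi⟩)
    · exact .refl (mem_piece_self _)
    · exact (connIn_setOf_reachIn v (.refl hi.left_mem) u hi).mono fun z hz => .inr ⟨i, hz⟩
  exact fun u hu w hw => (key u hu).symm.trans (key w hw)

theorem piece_subset (hU : ∀ i j, i ≠ j → Disjoint (U i) (U j)) {i : ι} {v : V} (hv : v ∈ U i) :
    piece U N v ⊆ U i := by
  rintro u (rfl | ⟨j, hj⟩)
  · exact hv
  · by_cases h : i = j
    · exact h ▸ hj.right_mem
    · exact absurd hj.left_mem (Set.disjoint_left.1 (hU i j h) hv)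

theorem piece_eq_of_mem (hU : ∀ i j, i ≠ j → Disjoint (U i) (U j)) {u v : V}
    (h : u ∈ piece U N v) : piece U N u = piece U N v := by
  rcases h with rfl | ⟨i, hi⟩
  · rfl
  · have key : ∀ {a b z : V}, ReachIn N.planar (U i) a b → z ∈ piece U N a → z ∈ piece U N b := by
      rintro a b z hab (rfl | ⟨j, hj⟩)
      · exact .inr ⟨i, hab.symm⟩
      · by_cases h : i = j
        · subst h
          exact .inr ⟨i, hab.symm.trans hj⟩
        · exact absurd hj.left_mem (Set.disjoint_left.1 (hU i j h) hab.left_mem)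
    exact Set.ext fun z => ⟨key hi.symm, key hi⟩

theorem disjoint_piece (hU : ∀ i j, i ≠ j → Disjoint (U i) (U j)) {u v : V}
    (h : u ∉ piece U N v) : Disjoint (piece U N v) (piece U N u) := by
  rw [Set.disjoint_left]
  intro z hz hz'
  apply h
  rw [← piece_eq_of_mem hU hz, piece_eq_of_mem hU hz']
  exact mem_piece_self u

theorem Linked.separatesPieces {x u : V} (h : Linked U N x u) (hx : x ∈ N.ring)
    (hu : u ∈ N.ring) : SeparatesPieces U N x u := by
  obtain ⟨B, hB, hBc, hxB, huB⟩ := h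
  intro i j D _ hD hDx hDu p hp hpr q hq hqr
  refine noncrossing (B := B) (T := D) ?_ (hBc x hxB u huB) (hD p hp q hq) hx hu hpr hqr
  exact (Set.disjoint_union_left.2 ⟨hDx, hDu⟩).mono_left hB

theorem inside_iff_of_separatesPieces (hU : ∀ i j, i ≠ j → Disjoint (U i) (U j)) {x y : V}
    (hxy : SeparatesPieces U N x y) (hx : x ∈ N.ring) (hy : y ∈ N.ring) {i j : ι}
    (hT : ConnIn N.graph (U i ∪ U j))
    (hxT : x ∉ U i ∪ U j) (hyT : y ∉ U i ∪ U j) (hx' : N.gate x ∉ U i ∪ U j)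
    (hy' : N.gate y ∉ U i ∪ U j) {p q : V} (hp : p ∈ N.ring) (hq : q ∈ N.ring)
    (hpT : p ∈ U i ∪ U j) (hqT : q ∈ U i ∪ U j) : N.Inside x y p ↔ N.Inside x y q := by
  refine inside_iff_of_planar hT hx hy hxT hyT hx' hy' (fun p hp q hq hpq => ?_) hp hq hpT hqT
  have hd : ∀ z, z ∉ U i ∪ U j → Disjoint (piece U N z) (U i ∪ U j) := by
    intro z hz
    rw [Set.disjoint_left]
    intro a ha ha'
    have hza : z ∈ piece U N a := (piece_eq_of_mem hU ha) ▸ mem_piece_self z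
    rcases ha' with h | h
    · exact hz (.inl (piece_subset hU h hza))
    · exact hz (.inr (piece_subset hU h hza))
  obtain ⟨w, hw⟩ := hpq
  exact hxy i j {z | z ∈ w.support} hw (connIn_support w) ((hd x hxT).mono_right hw)
    ((hd y hyT).mono_right hw) p w.start_mem_support hp q w.end_mem_support hq

/-- The induction step of the triangulation of the outer face: if the pair `x`, `y` separates, and
`x`, `u` separates for some `u` between them beyond which no vertex is linked to `x`, then the pair
`u`, `y` separates as well. -/
theorem SeparatesPieces.right (hU : ∀ i j, i ≠ j → Disjoint (U i) (U j))
    (hring : ∀ i, ∀ v ∈ U i, ∃ t ∈ N.ring, t ∈ piece U N v)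
    {x y u : V} (hxy : SeparatesPieces U N x y) (hxu : SeparatesPieces U N x u)
    (hu : u ∈ N.ring) (h1 : N.pos x < N.pos u) (h2 : N.pos u < N.pos y)
    (hlast : ∀ p ∈ N.ring, N.pos u < N.pos p → N.pos p < N.pos y → ¬ Linked U N x p) :
    SeparatesPieces U N u y := by
  -- first the sets that also avoid the component of `x`
  have avoid : ∀ i j (D : Set V), D ⊆ U i ∪ U j → ConnIn N.planar D → Disjoint (piece U N x) D →
      Disjoint (piece U N u) D → Disjoint (piece U N y) D → ∀ p ∈ D, p ∈ N.ring →
      ∀ q ∈ D, q ∈ N.ring → N.Inside u y p → N.Inside u y q := by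
    intro i j D hD hDc hDx hDu hDy p hp hpr q hq hqr hin
    have e1 := (hxy i j D hD hDc hDx hDy p hp hpr q hq hqr)
    have e2 := (hxu i j D hD hDc hDx hDu p hp hpr q hq hqr)
    have e3 : N.pos q ≠ N.pos u := fun h =>
      Set.disjoint_left.1 hDu (mem_piece_self u) (N.pos_injOn hqr hu h ▸ hq)
    unfold Inside at *
    omega
  have main : ∀ i j (D : Set V), D ⊆ U i ∪ U j → ConnIn N.planar D → Disjoint (piece U N u) D →
      Disjoint (piece U N y) D → ∀ p ∈ D, p ∈ N.ring → ∀ q ∈ D, q ∈ N.ring →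
      N.Inside u y p → N.Inside u y q := by
    intro i j D hD hDc hDu hDy p hp hpr q hq hqr hin
    by_cases hDx : Disjoint (piece U N x) D
    · exact avoid i j D hD hDc hDx hDu hDy p hp hpr q hq hqr hin
    exfalso
    obtain ⟨z, hzx, hzD⟩ := Set.not_disjoint_iff.1 hDx
    have hinx : N.pos u < N.pos p ∧ N.pos p < N.pos y := by
      unfold Inside at hin
      omega
    have hpx : p ∉ piece U N x := by
      intro hpx
      refine hlast p hpr hinx.1 hinx.2
        ⟨piece U N x, Set.subset_union_left, connIn_piece x, mem_piece_self x, hpx⟩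
    -- follow `D` from `p` until just before it enters the component of `x`
    have hfirst : ∃ r s, ReachIn N.planar (D \ piece U N x) p r ∧ N.planar.Adj r s ∧
        s ∈ piece U N x := by
      obtain ⟨w, hw⟩ := hDc p hp z hzD
      clear hin hinx hpr
      induction w with
      | nil => exact absurd hzx hpx
      | @cons a b z hab w ih =>
        by_cases hb : b ∈ piece U N x
        · exact ⟨a, b, .refl ⟨hp, hpx⟩, hab, hb⟩
        · have hbD : b ∈ D := hw _ (by simp)
          obtain ⟨r, s, hr, hrs, hs⟩ := ih hbD hzx hzD hb (fun z hz => hw z (by simp [hz]))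
          exact ⟨r, s, (ReachIn.of_adj (T := D \ piece U N x) hab ⟨hp, hpx⟩ ⟨hbD, hb⟩).trans hr,
            hrs, hs⟩
    obtain ⟨r, s, hpr', hrs, hs⟩ := hfirst
    have hrD : r ∈ D := hpr'.right_mem.1
    have hrx : r ∉ piece U N x := hpr'.right_mem.2
    have hru : r ∉ piece U N u := fun h => Set.disjoint_left.1 hDu h hrD
    have hry : r ∉ piece U N y := fun h => Set.disjoint_left.1 hDy h hrD
    obtain ⟨l, hrl, hlsub⟩ : ∃ l, r ∈ U l ∧ U l ⊆ U i ∪ U j := by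
      rcases hD hrD with h | h
      exacts [⟨i, h, Set.subset_union_left⟩, ⟨j, h, Set.subset_union_right⟩]
    obtain ⟨t, htr, ht⟩ := hring l r hrl
    have hlink : Linked U N x t := by
      refine ⟨piece U N x ∪ piece U N r, ?_, ?_, .inl (mem_piece_self x), .inr ht⟩
      · rw [piece_eq_of_mem hU ht]
      · exact (connIn_piece x).union_of_adj (connIn_piece r)
          ⟨s, hs, r, mem_piece_self r, hrs.symm⟩
    obtain ⟨w, hw⟩ := hpr'
    have hcon : ConnIn N.planar ({v | v ∈ w.support} ∪ piece U N r) :=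
      (connIn_support w).union_of_mem (connIn_piece r)
        ⟨r, w.end_mem_support, mem_piece_self r⟩
    have hin' := avoid i j ({v | v ∈ w.support} ∪ piece U N r)
      (Set.union_subset (fun v hv => hD (hw v hv).1) ((piece_subset hU hrl).trans hlsub)) hcon
      (Set.disjoint_union_right.2 ⟨Set.disjoint_left.2 fun v hv hv' => (hw v hv').2 hv,
        disjoint_piece hU hrx⟩)
      (Set.disjoint_union_right.2 ⟨Set.disjoint_left.2 fun v hv hv' =>
        Set.disjoint_left.1 hDu hv (hw v hv').1, disjoint_piece hU hru⟩)
      (Set.disjoint_union_right.2 ⟨Set.disjoint_left.2 fun v hv hv' =>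
        Set.disjoint_left.1 hDy hv (hw v hv').1, disjoint_piece hU hry⟩)
      p (.inl w.start_mem_support) hpr t (.inr ht) htr hin
    refine hlast t htr ?_ ?_ hlink <;> (unfold Inside at hin'; omega)
  intro i j D hD hDc hDu hDy p hp hpr q hq hqr
  exact ⟨main i j D hD hDc hDu hDy p hp hpr q hq hqr, main i j D hD hDc hDu hDy q hq hqr p hp hpr⟩

theorem exists_forall_le_of_nat {α : Type*} {P : α → Prop} (f : α → ℕ) (h : ∃ a, P a) :
    ∃ a, P a ∧ ∀ b, P b → f a ≤ f b := by
  obtain ⟨a, ha⟩ := h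
  have hne : {n | ∃ a, P a ∧ f a = n}.Nonempty := ⟨f a, a, ha, rfl⟩
  obtain ⟨b, hb, hbf⟩ := Nat.sInf_mem hne
  exact ⟨b, hb, fun c hc => hbf ▸ Nat.sInf_le ⟨c, hc, rfl⟩⟩

/-- A 5-connected graph with at least seven vertices has no model all of whose branch sets meet the
ring: the outer face is triangulated by pairs of ring vertices that are linked or consecutive, each
such pair is a separation of order at most four, and each triangle meets at most six branch sets.
Five-connectedness is used in the form `hconn`. -/
theorem no_model_on_ring [Finite V] [Fintype ι] (hU : ∀ i j, i ≠ j → Disjoint (U i) (U j))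
    (hc : ∀ i, ConnIn N.graph (U i)) (hr : ∀ i, (U i ∩ N.ring).Nonempty)
    (hcard : 7 ≤ Fintype.card ι)
    (hconn : ∀ S : Finset ι, S.card ≤ 4 → ∀ i j, i ∉ S → j ∉ S → ∃ l, l ∉ S ∧
      (i = l ∨ ∃ u ∈ U i, ∃ v ∈ U l, N.graph.Adj u v) ∧
      (l = j ∨ ∃ u ∈ U l, ∃ v ∈ U j, N.graph.Adj u v)) : False := by
  classical
  have hring : ∀ i, ∀ v ∈ U i, ∃ t ∈ N.ring, t ∈ piece U N v := by
    intro i v hv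
    obtain ⟨r, hrU, hrr⟩ := hr i
    obtain ⟨t, ht, h⟩ := exists_reachIn_ring (hc i) hrr hrU hv
    exact ⟨t, ht, .inr ⟨i, h⟩⟩
  let hit : V → Finset ι := fun z => Finset.univ.filter fun i => z ∈ U i
  have mem_hit : ∀ {z i}, i ∈ hit z ↔ z ∈ U i := by simp [hit]
  have hit_card : ∀ z, (hit z).card ≤ 1 := fun z => Finset.card_le_one.2 fun i hi j hj => by
    by_contra h
    exact Set.disjoint_left.1 (hU i j h) (mem_hit.1 hi) (mem_hit.1 hj)
  let cut : V → Finset ι := fun z => hit z ∪ hit (N.gate z)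
  have cut_card : ∀ z, (cut z).card ≤ 2 := fun z =>
    (Finset.card_union_le _ _).trans (by have := hit_card z; have := hit_card (N.gate z); omega)
  have notMem_cut : ∀ {z i}, i ∉ cut z → z ∉ U i ∧ N.gate z ∉ U i := by
    intro z i h
    simpa [cut, mem_hit] using h
  -- all branch sets that avoid the cut lie on the same side of it
  have side : ∀ x ∈ N.ring, ∀ y ∈ N.ring, SeparatesPieces U N x y →
      ∀ i j, i ∉ cut x → i ∉ cut y → j ∉ cut x → j ∉ cut y →
      ∀ p ∈ N.ring, p ∈ U i → ∀ q ∈ N.ring, q ∈ U j → (N.Inside x y p ↔ N.Inside x y q) := by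
    intro x hx y hy hxy i j hix hiy hjx hjy p hp hpi q hq hqj
    have step : ∀ i j, i ∉ cut x → i ∉ cut y → j ∉ cut x → j ∉ cut y →
        (i = j ∨ ∃ u ∈ U i, ∃ v ∈ U j, N.graph.Adj u v) →
        ∀ p ∈ N.ring, p ∈ U i → ∀ q ∈ N.ring, q ∈ U j → (N.Inside x y p ↔ N.Inside x y q) := by
      intro i j hix hiy hjx hjy hij p hp hpi q hq hqj
      have hT : ConnIn N.graph (U i ∪ U j) := by
        rcases hij with rfl | hij
        · simpa using hc i
        · exact (hc i).union_of_adj (hc j) hij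
      exact inside_iff_of_separatesPieces hU hxy hx hy hT
        (by simp [(notMem_cut hix).1, (notMem_cut hjx).1])
        (by simp [(notMem_cut hiy).1, (notMem_cut hjy).1])
        (by simp [(notMem_cut hix).2, (notMem_cut hjx).2])
        (by simp [(notMem_cut hiy).2, (notMem_cut hjy).2]) hp hq (.inl hpi) (.inr hqj)
    have hS : (cut x ∪ cut y).card ≤ 4 :=
      (Finset.card_union_le _ _).trans (by have := cut_card x; have := cut_card y; omega)
    obtain ⟨l, hl, hil, hlj⟩ := hconn (cut x ∪ cut y) hS i j (by simp [hix, hiy])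
      (by simp [hjx, hjy])
    simp only [Finset.mem_union, not_or] at hl
    obtain ⟨r, hrl, hrr⟩ := hr l
    exact (step i l hix hiy hl.1 hl.2 hil p hp hpi r hrr hrl).trans
      (step l j hl.1 hl.2 hjx hjy hlj r hrr hrl q hq hqj)
  have main : ∀ n, ∀ x ∈ N.ring, ∀ y ∈ N.ring, N.pos y - N.pos x ≤ n →
      SeparatesPieces U N x y → ∀ i, i ∉ cut x → i ∉ cut y → ∀ p ∈ N.ring, p ∈ U i →
      N.pos x < N.pos p → N.pos p < N.pos y → False := by
    intro n
    induction n with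
    | zero => intros; omega
    | succ n ih =>
      intro x hx y hy hn hxy i hix hiy p hp hpi hxp hpy
      obtain ⟨u, hu, hxu, huy, hsep, hlast⟩ : ∃ u ∈ N.ring, N.pos x < N.pos u ∧
          N.pos u < N.pos y ∧ SeparatesPieces U N x u ∧
          ∀ p ∈ N.ring, N.pos u < N.pos p → N.pos p < N.pos y → ¬ Linked U N x p := by
        by_cases hl : ∃ u, u ∈ N.ring ∧ N.pos x < N.pos u ∧ N.pos u < N.pos y ∧ Linked U N x u
        · obtain ⟨u, ⟨hu, hxu, huy, hlu⟩, hmax⟩ :=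
            exists_forall_le_of_nat (fun u => N.pos y - N.pos u) hl
          refine ⟨u, hu, hxu, huy, hlu.separatesPieces hx hu, fun p hp h1 h2 hlp => ?_⟩
          have := hmax p ⟨hp, by omega, h2, hlp⟩
          omega
        · obtain ⟨u, ⟨hu, hxu, huy⟩, hmin⟩ := exists_forall_le_of_nat
            (P := fun u => u ∈ N.ring ∧ N.pos x < N.pos u ∧ N.pos u < N.pos y) N.pos
            ⟨p, hp, hxp, hpy⟩
          refine ⟨u, hu, hxu, huy, ?_, fun p hp h1 h2 hlp => hl ⟨p, hp, by omega, h2, hlp⟩⟩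
          intro i j D _ _ _ _ p _ hpr q _ hqr
          have e1 := fun h1 h2 => hmin p ⟨hpr, h1, h2⟩
          have e2 := fun h1 h2 => hmin q ⟨hqr, h1, h2⟩
          unfold Inside
          omega
      have hsep' := hxy.right hU hring hsep hu hxu huy hlast
      have hS : (cut x ∪ cut y ∪ cut u).card ≤ 6 := by
        have h1 := Finset.card_union_le (cut x ∪ cut y) (cut u)
        have h2 := Finset.card_union_le (cut x) (cut y)
        have := cut_card x
        have := cut_card y
        have := cut_card u
        omega
      obtain ⟨j, hj⟩ : ∃ j, j ∉ cut x ∪ cut y ∪ cut u := by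
        by_contra! h
        have := Finset.card_le_card (fun j _ => h j : Finset.univ ⊆ cut x ∪ cut y ∪ cut u)
        rw [Finset.card_univ] at this
        omega
      simp only [Finset.mem_union, not_or] at hj
      obtain ⟨⟨hjx, hjy⟩, hju⟩ := hj
      obtain ⟨q, hqj, hqr⟩ := hr j
      have hq := (side x hx y hy hxy i j hix hiy hjx hjy p hp hpi q hqr hqj).1 (.inl ⟨hxp, hpy⟩)
      have hne : N.pos q ≠ N.pos u := fun h =>
        (notMem_cut hju).1 (N.pos_injOn hqr hu h ▸ hqj)
      have hq' : N.pos x < N.pos q ∧ N.pos q < N.pos y := by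
        unfold Inside at hq
        omega
      rcases lt_or_gt_of_ne hne with h | h
      · exact ih x hx u hu (by omega) hsep j hjx hju q hqr hqj hq'.1 h
      · exact ih u hu y hy (by omega) hsep' j hju hjy q hqr hqj h hq'.2
  have hne : N.ring.Nonempty := by
    have : Nonempty ι := Fintype.card_pos_iff.1 (by omega)
    exact (hr (Classical.arbitrary ι)).mono Set.inter_subset_right
  -- start with the first and the last ring vertex
  obtain ⟨x, hx, hxmin⟩ := Set.exists_min_image N.ring N.pos N.ring.toFinite hne
  obtain ⟨y, hy, hymax⟩ := Set.exists_max_image N.ring N.pos N.ring.toFinite hne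
  have strict : ∀ p ∈ N.ring, p ≠ x → p ≠ y → N.pos x < N.pos p ∧ N.pos p < N.pos y := by
    intro p hp hpx hpy
    exact ⟨(hxmin p hp).lt_of_ne fun h => hpx (N.pos_injOn hx hp h).symm,
      (hymax p hp).lt_of_ne fun h => hpy (N.pos_injOn hp hy h)⟩
  have hxy : SeparatesPieces U N x y := by
    intro i j D _ _ hDx hDy p hp hpr q hq hqr
    have ne : ∀ {z w}, Disjoint (piece U N z) D → w ∈ D → w ≠ z := fun h hw hwz =>
      Set.disjoint_left.1 h (mem_piece_self _) (hwz ▸ hw)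
    exact iff_of_true (.inl (strict p hpr (ne hDx hp) (ne hDy hp)))
      (.inl (strict q hqr (ne hDx hq) (ne hDy hq)))
  obtain ⟨i, hi⟩ : ∃ i, i ∉ cut x ∪ cut y := by
    by_contra! h
    have h1 := Finset.card_le_card (fun j _ => h j : Finset.univ ⊆ cut x ∪ cut y)
    have h2 := Finset.card_union_le (cut x) (cut y)
    have := cut_card x
    have := cut_card y
    rw [Finset.card_univ] at h1
    omega
  simp only [Finset.mem_union, not_or] at hi
  obtain ⟨p, hpi, hpr⟩ := hr i
  obtain ⟨h1, h2⟩ := strict p hpr (fun h => (notMem_cut hi.1).1 (h ▸ hpi))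
    (fun h => (notMem_cut hi.2).1 (h ▸ hpi))
  exact main _ x hx y hy le_rfl hxy i hi.1 hi.2 p hpr hpi h1 h2

end AllOnRing

end VortexSociety

/-! ### Complete bipartite minors with many branch sets off the ring -/

namespace VortexSociety

variable {V : Type*}

/-- Branch sets of a complete bipartite minor with colour classes `α` and `β` of the graph of the
society `N`. -/
structure BicliqueModel (N : VortexSociety V) {α β : Type*} (A : α → Set V) (B : β → Set V) :
    Prop where
  conn_left : ∀ i, ConnIn N.graph (A i)
  conn_right : ∀ j, ConnIn N.graph (B j)
  disj_left : ∀ i i', i ≠ i' → Disjoint (A i) (A i')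
  disj_right : ∀ j j', j ≠ j' → Disjoint (B j) (B j')
  disj : ∀ i j, Disjoint (A i) (B j)
  adj : ∀ i j, ∃ u ∈ A i, ∃ v ∈ B j, N.graph.Adj u v

namespace BicliqueModel

variable {N : VortexSociety V} {α β α' β' : Type*} {A : α → Set V} {B : β → Set V}

theorem symm (h : BicliqueModel N A B) : BicliqueModel N B A :=
  ⟨h.conn_right, h.conn_left, h.disj_right, h.disj_left, fun i j => (h.disj j i).symm, fun i j =>
    let ⟨u, hu, v, hv, huv⟩ := h.adj j i
    ⟨v, hv, u, hu, huv.symm⟩⟩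

theorem comp (h : BicliqueModel N A B) {f : α' → α} {g : β' → β} (hf : Function.Injective f)
    (hg : Function.Injective g) : BicliqueModel N (A ∘ f) (B ∘ g) :=
  ⟨fun i => h.conn_left (f i), fun j => h.conn_right (g j),
    fun _ _ hi => h.disj_left _ _ (hf.ne hi), fun _ _ hj => h.disj_right _ _ (hg.ne hj),
    fun _ _ => h.disj _ _, fun _ _ => h.adj _ _⟩

theorem planar_adj (h : BicliqueModel N A B) {i : α} (hi : Disjoint (A i) N.ring) (j : β) :
    ∃ u ∈ A i, ∃ v ∈ B j, N.planar.Adj u v := by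
  obtain ⟨u, hu, v, hv, huv⟩ := h.adj i j
  exact ⟨u, hu, v, hv, planar_adj_of_notMem_ring huv (Set.disjoint_left.1 hi hu)⟩

theorem planar_conn (h : BicliqueModel N A B) {i : α} (hi : Disjoint (A i) N.ring) :
    ConnIn N.planar (A i) :=
  connIn_planar_of_disjoint_ring (h.conn_left i) hi

theorem exists_leg (h : BicliqueModel N A B) {i : α} (hi : Disjoint (A i) N.ring) {j : β}
    (hj : (B j ∩ N.ring).Nonempty) : ∃ L t, N.IsLeg (A i) (B j) L t :=
  exists_isLeg hi (h.conn_right j) hj (h.adj i j)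

end BicliqueModel

theorem IsLeg.adj_symm {N : VortexSociety V} {X T L : Set V} {t : V} (h : N.IsLeg X T L t) :
    ∃ u ∈ L, ∃ v ∈ X, N.planar.Adj u v := by
  obtain ⟨u, hu, v, hv, huv⟩ := h.adj
  exact ⟨v, hv, u, hu, huv.symm⟩

theorem IsLeg.union {N : VortexSociety V} {X T L : Set V} {t : V} (h : N.IsLeg X T L t)
    (hX : ConnIn N.planar X) : ConnIn N.planar (L ∪ X) :=
  h.conn.union_of_adj hX h.adj_symm

variable {N : VortexSociety V}

theorem _root_.Exists.adj_mono {G : SimpleGraph V} {S S' T T' : Set V}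
    (h : ∃ u ∈ S, ∃ v ∈ T, G.Adj u v) (hS : S ⊆ S') (hT : T ⊆ T') :
    ∃ u ∈ S', ∃ v ∈ T', G.Adj u v := by
  obtain ⟨u, hu, v, hv, huv⟩ := h
  exact ⟨u, hS hu, v, hT hv, huv⟩

/-- Branch sets off the ring cannot form a `K_{3,3}`. -/
theorem BicliqueModel.false_of_three_three {A B : Fin 3 → Set V} (h : BicliqueModel N A B)
    (hA : ∀ i, Disjoint (A i) N.ring) (hB : ∀ j, Disjoint (B j) N.ring) : False :=
  no_planar_K33 (fun i => h.planar_conn (hA i)) (fun j => h.symm.planar_conn (hB j))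
    h.disj_left h.disj_right h.disj (fun i j => h.planar_adj (hA i) j)

/-- Three branch sets off the ring on one side, and two on the other: the former can be extended to
the ring by legs, giving an outer `K_{2,3}`. -/
theorem BicliqueModel.false_of_three_two {A : Fin 3 → Set V} {B : Fin 2 ⊕ Fin 3 → Set V}
    (h : BicliqueModel N A B) (hA : ∀ i, Disjoint (A i) N.ring)
    (hB : ∀ j, Disjoint (B (.inl j)) N.ring) (hB' : ∀ j, (B (.inr j) ∩ N.ring).Nonempty) :
    False := by
  choose L t hL using fun i : Fin 3 => h.exists_leg (hA i) (hB' i)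
  have dLA : ∀ i i', Disjoint (L i) (A i') := fun i i' =>
    (h.disj i' _).symm.mono_left (hL i).subset
  refine no_planar_K23 (N := N) (A := fun j => B (.inl j)) (B := fun i => L i ∪ A i) (π := t)
    (fun j => h.symm.planar_conn (hB j)) (fun i => (hL i).union (h.planar_conn (hA i)))
    (h.disj_right _ _ (by simp)) (fun i i' hi => ?_) (fun j i => ?_) (fun i => .inl (hL i).mem)
    (fun i => (hL i).mem_ring)
    (fun j i => (h.symm.planar_adj (hB j) i).adj_mono subset_rfl Set.subset_union_right)
  · simp only [Set.disjoint_union_left, Set.disjoint_union_right]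
    exact ⟨⟨(h.disj_right _ _ (by simpa using hi)).mono (hL i).subset (hL i').subset,
      (dLA _ _).symm⟩, dLA _ _, h.disj_left _ _ hi⟩
  · exact Set.disjoint_union_right.2
      ⟨(h.disj_right _ _ (by simp)).mono_right (hL i).subset, (h.disj i _).symm⟩

/-- Two branch sets off the ring on one side, while all five on the other side meet the ring. -/
theorem BicliqueModel.false_of_two_zero {A : Fin 2 → Set V} {B : Fin 5 → Set V}
    (h : BicliqueModel N A B) (hA : ∀ i, Disjoint (A i) N.ring)
    (hB : ∀ j, (B j ∩ N.ring).Nonempty) : False := by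
  classical
  choose L t hL using fun (i : Fin 2) (j : Fin 5) => h.exists_leg (hA i) (hB j)
  have dAA : Disjoint (A 0) (A 1) := h.disj_left _ _ (by decide)
  have dLA : ∀ i j i', Disjoint (L i j) (A i') := fun i j i' =>
    (h.disj i' j).symm.mono_left (hL i j).subset
  have dLL : ∀ i j i' j', j ≠ j' → Disjoint (L i j) (L i' j') := fun i j i' j' hj =>
    (h.disj_right j j' hj).mono (hL i j).subset (hL i' j').subset
  have dLB : ∀ i j j', j ≠ j' → Disjoint (L i j) (B j') := fun i j j' hj =>
    (h.disj_right j j' hj).mono_left (hL i j).subset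
  have hpos : ∀ {i j i' j'}, j ≠ j' → N.pos (t i j) ≠ N.pos (t i' j') := fun {i j i' j'} hj e =>
    Set.disjoint_left.1 (dLL i j i' j' hj) (hL i j).mem
      (N.pos_injOn (hL i j).mem_ring (hL i' j').mem_ring e ▸ (hL i' j').mem)
  -- the two legs of some `B b` are disjoint
  obtain ⟨b, hb⟩ : ∃ b, Disjoint (L 0 b) (L 1 b) := by
    by_contra! hne
    refine no_planar_K23 (N := N) (A := A)
      (B := fun j : Fin 3 => L 0 (j.castLE (by decide)) ∪ L 1 (j.castLE (by decide)))
      (π := fun j => t 0 (j.castLE (by decide)))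
      (fun i => h.planar_conn (hA i)) (fun j => ?_) dAA
      (fun j j' hj => ?_) (fun i j => ?_) (fun j => .inl (hL 0 _).mem)
      (fun j => (hL 0 _).mem_ring) (fun i j => ?_)
    · exact (hL 0 _).conn.union_of_mem (hL 1 _).conn (Set.not_disjoint_iff_nonempty_inter.1 (hne _))
    · have : j.castLE (by decide : 3 ≤ 5) ≠ j'.castLE (by decide : 3 ≤ 5) := fun e =>
        hj (Fin.castLE_injective _ e)
      simp only [Set.disjoint_union_left, Set.disjoint_union_right]
      exact ⟨⟨dLL _ _ _ _ this, dLL _ _ _ _ this⟩, dLL _ _ _ _ this, dLL _ _ _ _ this⟩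
    · exact Set.disjoint_union_right.2 ⟨(dLA _ _ _).symm, (dLA _ _ _).symm⟩
    · fin_cases i
      · exact (hL 0 _).adj.adj_mono subset_rfl Set.subset_union_left
      · exact (hL 1 _).adj.adj_mono subset_rfl Set.subset_union_right
  -- go around the ring from `t 1 b`, and let `p` and `q` carry the first and the last leg of `A 0`
  obtain ⟨M, hM⟩ : ∃ M, ∀ j, N.pos (t 0 j) < M := by
    refine ⟨∑ j, N.pos (t 0 j) + 1, fun j => ?_⟩
    have := Finset.single_le_sum (f := fun j => N.pos (t 0 j)) (fun _ _ => Nat.zero_le _)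
      (Finset.mem_univ j)
    exact Nat.lt_succ_of_le this
  let key : Fin 5 → ℕ := fun j =>
    if N.pos (t 1 b) < N.pos (t 0 j) then N.pos (t 0 j) else N.pos (t 0 j) + M
  obtain ⟨p, -, hp⟩ := Finset.exists_min_image Finset.univ key ⟨0, Finset.mem_univ _⟩
  obtain ⟨q, -, hq⟩ := Finset.exists_max_image Finset.univ key ⟨0, Finset.mem_univ _⟩
  -- some `B j` is not met at the cut
  obtain ⟨j, hjp, hjq, hgp, hgq⟩ : ∃ j, j ≠ p ∧ j ≠ q ∧ N.gate (t 0 p) ∉ B j ∧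
      N.gate (t 0 q) ∉ B j := by
    let hit : V → Finset (Fin 5) := fun z => Finset.univ.filter fun j => z ∈ B j
    have hit_card : ∀ z, (hit z).card ≤ 1 := fun z => Finset.card_le_one.2 fun i hi j hj => by
      by_contra hij
      exact Set.disjoint_left.1 (h.disj_right i j hij) (by simpa [hit] using hi)
        (by simpa [hit] using hj)
    by_contra! hall
    have hsub : Finset.univ ⊆ ({p, q} ∪ (hit (N.gate (t 0 p)) ∪ hit (N.gate (t 0 q))) :
        Finset (Fin 5)) := by
      intro j _
      by_cases h1 : j = p
      · simp [h1]
      by_cases h2 : j = q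
      · simp [h2]
      by_cases h3 : N.gate (t 0 p) ∈ B j
      · simp [hit, h3]
      · simp [hit, hall j h1 h2 h3]
    have h1 := Finset.card_le_card hsub
    have h2 := Finset.card_union_le ({p, q} : Finset (Fin 5))
      (hit (N.gate (t 0 p)) ∪ hit (N.gate (t 0 q)))
    have h3 := Finset.card_union_le (hit (N.gate (t 0 p))) (hit (N.gate (t 0 q)))
    have h4 := hit_card (N.gate (t 0 p))
    have h5 := hit_card (N.gate (t 0 q))
    have h6 : ({p, q} : Finset (Fin 5)).card ≤ 2 := Finset.card_le_two
    rw [Finset.card_univ, Fintype.card_fin] at h1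
    omega
  have hbar : ConnIn N.planar (L 0 p ∪ A 0 ∪ L 0 q) :=
    ((hL 0 p).union (h.planar_conn (hA 0))).union_of_adj (hL 0 q).conn
      ((hL 0 q).adj.adj_mono Set.subset_union_right subset_rfl)
  have hpq : ReachIn N.planar (L 0 p ∪ A 0 ∪ L 0 q) (t 0 p) (t 0 q) :=
    hbar _ (.inl (.inl (hL 0 p).mem)) _ (.inr (hL 0 q).mem)
  have hT : ConnIn N.planar (L 1 j ∪ A 1 ∪ L 1 b) :=
    ((hL 1 j).union (h.planar_conn (hA 1))).union_of_adj (hL 1 b).conn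
      ((hL 1 b).adj.adj_mono Set.subset_union_right subset_rfl)
  have hLb : ∀ j, Disjoint (L 0 j) (L 1 b) := fun j => by
    by_cases hj : j = b
    · exact hj ▸ hb
    · exact dLL _ _ _ _ hj
  have hd : Disjoint (L 0 p ∪ A 0 ∪ L 0 q) (L 1 j ∪ A 1 ∪ L 1 b) := by
    simp [hLb, dAA, dLA, fun a b c => (dLA a b c).symm, dLL 0 p 1 j hjp.symm, dLL 0 q 1 j hjq.symm]
  have s1 := noncrossing hd hpq (hT _ (.inl (.inl (hL 1 j).mem)) _ (.inr (hL 1 b).mem))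
    (hL 0 p).mem_ring (hL 0 q).mem_ring (hL 1 j).mem_ring (hL 1 b).mem_ring
  have hd' : Disjoint (L 0 p ∪ A 0 ∪ L 0 q) (B j) := by
    simp only [Set.disjoint_union_left]
    exact ⟨⟨dLB _ _ _ hjp.symm, h.disj _ _⟩, dLB _ _ _ hjq.symm⟩
  have s2 := inside_iff_of_barrier (h.conn_right j) hd' hpq (hL 0 p).mem_ring (hL 0 q).mem_ring
    hgp hgq (hL 0 j).mem_ring (hL 1 j).mem_ring ((hL 0 j).subset (hL 0 j).mem)
    ((hL 1 j).subset (hL 1 j).mem)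
  have k1 := hp j (Finset.mem_univ _)
  have k2 := hq j (Finset.mem_univ _)
  have e1 := hpos (i := 0) (i' := 0) hjp
  have e2 := hpos (i := 0) (i' := 0) hjq
  have e3 : ∀ j, N.pos (t 0 j) ≠ N.pos (t 1 b) := fun j e =>
    Set.disjoint_left.1 (hLb j) (hL 0 j).mem
      (N.pos_injOn (hL 0 j).mem_ring (hL 1 b).mem_ring e ▸ (hL 1 b).mem)
  have e4 := e3 p
  have e5 := e3 q
  have e6 := e3 j
  have m1 := hM p
  have m2 := hM q
  have m3 := hM j
  simp only [key] at k1 k2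
  unfold Inside at s1 s2
  split_ifs at k1 k2 <;> omega

/-- Two branch sets off the ring on either side. They form a four-cycle, whose legs reach the ring
in cyclic order, so that two legs of one colour separate the ring between the legs of the other. -/
theorem BicliqueModel.false_of_two_two {A : Fin 2 ⊕ Fin 2 → Set V} {B : Fin 2 ⊕ Fin 3 → Set V}
    (h : BicliqueModel N A B) (hA : ∀ i, Disjoint (A (.inl i)) N.ring)
    (hA' : ∀ i, (A (.inr i) ∩ N.ring).Nonempty)
    (hB : ∀ j, Disjoint (B (.inl j)) N.ring) (hB' : ∀ j, (B (.inr j) ∩ N.ring).Nonempty) :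
    False := by
  choose L t hL using fun (i : Fin 2) (j : Fin 3) => h.exists_leg (hA i) (hB' j)
  choose K s hK using fun j : Fin 2 => h.symm.exists_leg (hB j) (hA' j)
  have dAA : Disjoint (A (.inl 0)) (A (.inl 1)) := h.disj_left _ _ (by simp)
  have dBB : Disjoint (B (.inl 0)) (B (.inl 1)) := h.disj_right _ _ (by simp)
  have dAB : ∀ i j, Disjoint (A i) (B j) := h.disj
  have dLA : ∀ i j i', Disjoint (L i j) (A i') := fun i j i' =>
    (h.disj i' _).symm.mono_left (hL i j).subset
  have dLB : ∀ i j j', Disjoint (L i j) (B (.inl j')) := fun i j j' =>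
    (h.disj_right _ _ (by simp)).mono_left (hL i j).subset
  have dKB : ∀ j j', Disjoint (K j) (B j') := fun j j' => (h.disj _ _).mono_left (hK j).subset
  have dKA : ∀ j i', Disjoint (K j) (A (.inl i')) := fun j i' =>
    (h.disj_left _ _ (by simp)).mono_left (hK j).subset
  have dKL : ∀ j i j', Disjoint (K j) (L i j') := fun j i j' =>
    (dKB _ _).mono_right (hL i j').subset
  have dKK : Disjoint (K 0) (K 1) :=
    (h.disj_left _ _ (by simp)).mono (hK 0).subset (hK 1).subset
  have cA : ∀ i, ConnIn N.planar (A (.inl i)) := fun i => h.planar_conn (hA i)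
  have cB : ∀ j, ConnIn N.planar (B (.inl j)) := fun j => h.symm.planar_conn (hB j)
  have legs : ∀ j, Disjoint (L 0 j) (L 1 j) := by
    intro j
    by_contra hne
    refine no_planar_K23 (N := N) (A := fun i => A (.inl i))
      (B := ![K 0 ∪ B (.inl 0), K 1 ∪ B (.inl 1), L 0 j ∪ L 1 j]) (π := ![s 0, s 1, t 0 j])
      cA ?_ dAA ?_ ?_ ?_ ?_ ?_
    · intro k
      fin_cases k
      · exact (hK 0).union (cB 0)
      · exact (hK 1).union (cB 1)
      · exact (hL 0 j).conn.union_of_mem (hL 1 j).conn (Set.not_disjoint_iff_nonempty_inter.1 hne)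
    · intro k k' hk
      fin_cases k <;> fin_cases k' <;>
        simp [dKK, dKK.symm, dBB, dBB.symm, dKB, fun a b => (dKB a b).symm, dKL,
          fun a b c => (dKL a b c).symm, dLB, fun a b c => (dLB a b c).symm] at hk ⊢
    · intro i k
      fin_cases k <;>
        simp [dAB, fun a b => (dKA a b).symm, fun a b c => (dLA a b c).symm]
    · intro k
      fin_cases k
      exacts [.inl (hK 0).mem, .inl (hK 1).mem, .inl (hL 0 j).mem]
    · intro k
      fin_cases k
      exacts [(hK 0).mem_ring, (hK 1).mem_ring, (hL 0 j).mem_ring]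
    · intro i k
      fin_cases k
      · exact (h.planar_adj (hA i) _).adj_mono subset_rfl Set.subset_union_right
      · exact (h.planar_adj (hA i) _).adj_mono subset_rfl Set.subset_union_right
      · fin_cases i
        · exact (hL 0 j).adj.adj_mono subset_rfl Set.subset_union_left
        · exact (hL 1 j).adj.adj_mono subset_rfl Set.subset_union_right
  have path : ∀ i j k, ReachIn N.planar (L i j ∪ A (.inl i) ∪ (K k ∪ B (.inl k))) (t i j) (s k) :=
    fun i j k => ((hL i j).union (cA i)).union_of_adj ((hK k).union (cB k))
      ((h.planar_adj (hA i) _).adj_mono Set.subset_union_right Set.subset_union_right)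
      _ (.inl (.inl (hL i j).mem)) _ (.inr (.inl (hK k).mem))
  -- hence every `B j` that meets the ring has to pass at `s 0` or at `s 1`
  have pass : ∀ j, N.gate (s 0) ∈ B (.inr j) ∨ N.gate (s 1) ∈ B (.inr j) := by
    intro j
    by_contra! hg
    have d1 : Disjoint (L 0 j ∪ A (.inl 0) ∪ (K 0 ∪ B (.inl 0)))
        (L 1 j ∪ A (.inl 1) ∪ (K 1 ∪ B (.inl 1))) := by
      simp [legs, dAA, dKK, dBB, dKB, fun a b => (dKB a b).symm, dKL,
          fun a b c => (dKL a b c).symm, dLB, fun a b c => (dLB a b c).symm, dAB,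
          fun a b => (dAB a b).symm, dKA, fun a b => (dKA a b).symm, dLA,
          fun a b c => (dLA a b c).symm]
    have d2 : Disjoint (L 0 j ∪ A (.inl 0) ∪ (K 1 ∪ B (.inl 1)))
        (L 1 j ∪ A (.inl 1) ∪ (K 0 ∪ B (.inl 0))) := by
      simp [legs, dAA, dKK.symm, dBB.symm, dKB, fun a b => (dKB a b).symm, dKL,
          fun a b c => (dKL a b c).symm, dLB, fun a b c => (dLB a b c).symm, dAB,
          fun a b => (dAB a b).symm, dKA, fun a b => (dKA a b).symm, dLA,
          fun a b c => (dLA a b c).symm]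
    have n1 := noncrossing d1 (path 0 j 0) (path 1 j 1) (hL _ _).mem_ring (hK _).mem_ring
      (hL _ _).mem_ring (hK _).mem_ring
    have n2 := noncrossing d2 (path 0 j 1) (path 1 j 0) (hL _ _).mem_ring (hK _).mem_ring
      (hL _ _).mem_ring (hK _).mem_ring
    have hbar : ConnIn N.planar (K 0 ∪ B (.inl 0) ∪ A (.inl 0) ∪ (K 1 ∪ B (.inl 1))) :=
      (((hK 0).union (cB 0)).union_of_adj (cA 0)
        ((h.symm.planar_adj (hB 0) _).adj_mono Set.subset_union_right subset_rfl)).union_of_adj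
        ((hK 1).union (cB 1))
        ((h.planar_adj (hA 0) _).adj_mono Set.subset_union_right Set.subset_union_right)
    have d3 : Disjoint (K 0 ∪ B (.inl 0) ∪ A (.inl 0) ∪ (K 1 ∪ B (.inl 1))) (B (.inr j)) := by
      simp only [Set.disjoint_union_left]
      exact ⟨⟨⟨dKB _ _, h.disj_right _ _ (by simp)⟩, dAB _ _⟩, dKB _ _, h.disj_right _ _ (by simp)⟩
    have n3 := inside_iff_of_barrier (h.conn_right (.inr j)) d3
      (hbar _ (.inl (.inl (.inl (hK 0).mem))) _ (.inr (.inl (hK 1).mem)))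
      (hK 0).mem_ring (hK 1).mem_ring hg.1 hg.2 (hL 0 j).mem_ring (hL 1 j).mem_ring
      ((hL 0 j).subset (hL 0 j).mem) ((hL 1 j).subset (hL 1 j).mem)
    have ne : ∀ i k, N.pos (t i j) ≠ N.pos (s k) := fun i k e =>
      Set.disjoint_left.1 (dKL k i j) (hK k).mem
        (N.pos_injOn (hL i j).mem_ring (hK k).mem_ring e ▸ (hL i j).mem)
    have e1 := ne 0 0
    have e2 := ne 0 1
    have e3 := ne 1 0
    have e4 := ne 1 1
    have e5 : N.pos (t 0 j) ≠ N.pos (t 1 j) := fun e =>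
      Set.disjoint_left.1 (legs j) (hL 0 j).mem
        (N.pos_injOn (hL 0 j).mem_ring (hL 1 j).mem_ring e ▸ (hL 1 j).mem)
    have e6 : N.pos (s 0) ≠ N.pos (s 1) := fun e =>
      Set.disjoint_left.1 dKK (hK 0).mem
        (N.pos_injOn (hK 0).mem_ring (hK 1).mem_ring e ▸ (hK 1).mem)
    unfold Inside at n1 n2 n3
    omega
  have : ∀ j, ∃ k : Fin 2, N.gate (s k) ∈ B (.inr j) := fun j =>
    (pass j).elim (fun h => ⟨0, h⟩) (fun h => ⟨1, h⟩)
  choose f hf using this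
  obtain ⟨j, j', hj, hjj⟩ := Fintype.exists_ne_map_eq_of_card_lt f (by simp)
  exact Set.disjoint_left.1 (h.disj_right (.inr j) (.inr j') (by simpa using hj)) (hf j)
    (hjj ▸ hf j')

end VortexSociety

/-! ### Three branch sets off the ring on one side, one on the other -/

namespace VortexSociety

variable {V : Type*} {N : VortexSociety V}

section ThreeOne

variable {A : Fin 3 → Set V} {Y : Set V} {B : Fin 4 → Set V} {L : Fin 3 → Fin 4 → Set V}
  {t : Fin 3 → Fin 4 → V}

theorem inside_iff_of_lt {x y p : V} (h : N.pos x < N.pos y) :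
    N.Inside x y p ↔ N.pos x < N.pos p ∧ N.pos p < N.pos y := by
  unfold Inside
  omega

/-- Three branch sets `A i` off the ring on one side, a branch set `Y` off the ring and four branch
sets `B j` that meet the ring on the other. Here the legs of `B b` are supposed to be disjoint, and
to reach the ring in the order given by their indices.

Each of the other three sets `B (β i)` has to pass exactly one of these three legs, say that of
index `i`. Then `B (β 0)` and `B (β 1)` block the leg of `B (β 1)` to `A 0` and that of `B (β 2)` to
`A 1` for all others, and `B b` is cut into two parts. -/
theorem BicliqueModel.false_of_three_one_aux
    (h : BicliqueModel N A (fun o : Option (Fin 4) => o.elim Y B))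
    (hA : ∀ i, Disjoint (A i) N.ring) (hY : Disjoint Y N.ring)
    (hL : ∀ i j, N.IsLeg (A i) (B j) (L i j) (t i j)) (b : Fin 4)
    (hb : ∀ i i', i ≠ i' → Disjoint (L i b) (L i' b))
    (h01 : N.pos (t 0 b) < N.pos (t 1 b)) (h12 : N.pos (t 1 b) < N.pos (t 2 b)) : False := by
  have dAA := h.disj_left
  have dBB : ∀ j j', j ≠ j' → Disjoint (B j) (B j') := fun j j' hj =>
    h.disj_right (some j) (some j') (by simpa using hj)
  have dAB : ∀ i j, Disjoint (A i) (B j) := fun i j => h.disj i (some j)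
  have dAY : ∀ i, Disjoint (A i) Y := fun i => h.disj i none
  have dYB : ∀ j, Disjoint Y (B j) := fun j => h.disj_right none (some j) (by simp)
  have dLA : ∀ i j i', Disjoint (L i j) (A i') := fun i j i' =>
    (dAB i' j).symm.mono_left (hL i j).subset
  have dLY : ∀ i j, Disjoint (L i j) Y := fun i j => (dYB j).symm.mono_left (hL i j).subset
  have dLB : ∀ i j j', j ≠ j' → Disjoint (L i j) (B j') := fun i j j' hj =>
    (dBB j j' hj).mono_left (hL i j).subset
  have dLL : ∀ i j i' j', j ≠ j' → Disjoint (L i j) (L i' j') := fun i j i' j' hj =>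
    (dLB i j j' hj).mono_right (hL i' j').subset
  have cA : ∀ i, ConnIn N.planar (A i) := fun i => h.planar_conn (hA i)
  have cY : ConnIn N.planar Y := h.symm.planar_conn (i := none) hY
  have aAY : ∀ i, ∃ u ∈ A i, ∃ v ∈ Y, N.planar.Adj u v := fun i => h.planar_adj (hA i) none
  have aYA : ∀ i, ∃ u ∈ Y, ∃ v ∈ A i, N.planar.Adj u v := fun i =>
    h.symm.planar_adj (i := none) hY i
  have tB : ∀ i j, t i j ∈ B j := fun i j => (hL i j).subset (hL i j).mem
  have tr : ∀ i j, t i j ∈ N.ring := fun i j => (hL i j).mem_ring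
  have hpos : ∀ {i j i' j'}, j ≠ j' → N.pos (t i j) ≠ N.pos (t i' j') := fun {i j i' j'} hj e =>
    Set.disjoint_left.1 (dBB j j' hj) (tB i j) (N.pos_injOn (tr i j) (tr i' j') e ▸ tB i' j')
  -- connections through one `A i`, and through `A i`, `Y` and `A i'`
  have path₁ : ∀ i j j', ReachIn N.planar (L i j ∪ A i ∪ L i j') (t i j) (t i j') :=
    fun i j j' => ((hL i j).union (cA i)).union_of_adj (hL i j').conn
      ((hL i j').adj.adj_mono Set.subset_union_right subset_rfl)
      _ (.inl (.inl (hL i j).mem)) _ (.inr (hL i j').mem)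
  have path₂ : ∀ i j i' j', ReachIn N.planar (L i j ∪ A i ∪ Y ∪ (L i' j' ∪ A i'))
      (t i j) (t i' j') :=
    fun i j i' j' => (((hL i j).union (cA i)).union_of_adj cY
        ((aAY i).adj_mono Set.subset_union_right subset_rfl)).union_of_adj
        ((hL i' j').union (cA i'))
        ((aYA i').adj_mono Set.subset_union_right Set.subset_union_right)
      _ (.inl (.inl (.inl (hL i j).mem))) _ (.inr (.inl (hL i' j').mem))
  have side : ∀ i j i' j' l, j ≠ l → j' ≠ l → N.gate (t i j) ∉ B l → N.gate (t i' j') ∉ B l →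
      ∀ m m', N.Inside (t i j) (t i' j') (t m l) ↔ N.Inside (t i j) (t i' j') (t m' l) := by
    intro i j i' j' l hj hj' hg hg' m m'
    refine inside_iff_of_barrier (h.conn_right (some l)) ?_ (path₂ i j i' j') (tr i j) (tr i' j')
      hg hg' (tr m l) (tr m' l) (tB m l) (tB m' l)
    change Disjoint _ (B l)
    simp [dAB, dYB, dLB i j l hj, dLB i' j' l hj']
  have window : ∀ i i' m, i ≠ i' → m ≠ i → m ≠ i' → ∀ l, l ≠ b →
      (N.Inside (t i b) (t i' b) (t m l) ↔ N.Inside (t i b) (t i' b) (t m b)) := by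
    intro i i' m hi hm hm' l hl
    refine noncrossing ?_ (path₂ i b i' b) (path₁ m l b) (tr i b) (tr i' b) (tr m l) (tr m b)
    simp [dLA, fun a b c => (dLA a b c).symm, fun a b => (dLY a b).symm,
      fun a => (dAY a).symm, dAA i m hm.symm, dAA i' m hm'.symm, hb i m hm.symm, hb i' m hm'.symm,
      dLL i b m l hl.symm, dLL i' b m l hl.symm]
  have order : ∀ i i' l l', i ≠ i' → l ≠ b → l' ≠ b → l ≠ l' →
      (N.Inside (t i b) (t i l) (t i' l') ↔ N.Inside (t i b) (t i l) (t i' b)) := by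
    intro i i' l l' hi hl hl' hll
    refine noncrossing ?_ (path₁ i b l) (path₁ i' l' b) (tr i b) (tr i l) (tr i' l') (tr i' b)
    simp [dLA, fun a b c => (dLA a b c).symm, dAA i i' hi, hb i i' hi, dLL i b i' l' hl'.symm,
      dLL i l i' l' hll, dLL i l i' b hl]
  have h02 := h01.trans h12
  -- the legs to `A i` of the other sets stay off the part of the ring opposite to `t i b`
  have win0 : ∀ l, l ≠ b →
      ¬ (N.pos (t 1 b) < N.pos (t 0 l) ∧ N.pos (t 0 l) < N.pos (t 2 b)) := by
    intro l hl
    have := window 1 2 0 (by decide) (by decide) (by decide) l hl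
    rw [inside_iff_of_lt h12, inside_iff_of_lt h12] at this
    omega
  have win1 : ∀ l, l ≠ b → N.pos (t 0 b) < N.pos (t 1 l) ∧ N.pos (t 1 l) < N.pos (t 2 b) := by
    intro l hl
    have := window 0 2 1 (by decide) (by decide) (by decide) l hl
    rw [inside_iff_of_lt h02, inside_iff_of_lt h02] at this
    omega
  have win2 : ∀ l, l ≠ b →
      ¬ (N.pos (t 0 b) < N.pos (t 2 l) ∧ N.pos (t 2 l) < N.pos (t 1 b)) := by
    intro l hl
    have := window 0 1 2 (by decide) (by decide) (by decide) l hl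
    rw [inside_iff_of_lt h01, inside_iff_of_lt h01] at this
    omega
  -- each other set passes one of the three legs of `B b`
  have pass : ∀ l, l ≠ b → ∃ i, N.gate (t i b) ∈ B l := by
    intro l hl
    by_contra! hg
    have s1 := side 0 b 1 b l hl.symm hl.symm (hg 0) (hg 1) 1 2
    have s2 := side 1 b 2 b l hl.symm hl.symm (hg 1) (hg 2) 1 0
    rw [inside_iff_of_lt h01, inside_iff_of_lt h01] at s1
    rw [inside_iff_of_lt h12, inside_iff_of_lt h12] at s2
    have := win0 l hl
    have := win1 l hl
    have := win2 l hl
    have := hpos (i := 1) (i' := 1) hl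
    omega
  choose f hf using fun l : {l // l ≠ b} => pass l l.2
  have hfinj : Function.Injective f := by
    intro l l' hll
    by_contra hne
    exact Set.disjoint_left.1 (dBB l l' fun e => hne (Subtype.ext e)) (hf l) (hll ▸ hf l')
  have hfsurj : Function.Surjective f :=
    ((Fintype.bijective_iff_injective_and_card f).2 ⟨hfinj, by simp⟩).2
  choose g hg using hfsurj
  obtain ⟨β, hβ⟩ : ∃ β : Fin 3 → Fin 4, ∀ i, β i = (g i : Fin 4) := ⟨fun i => g i, fun _ => rfl⟩
  have hβb : ∀ i, β i ≠ b := fun i => hβ i ▸ (g i).2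
  have hβg : ∀ i, N.gate (t i b) ∈ B (β i) := fun i => by
    have := hf (g i)
    rwa [hg i, ← hβ i] at this
  have hββ : ∀ i i', i ≠ i' → β i ≠ β i' := by
    intro i i' hi e
    rw [hβ, hβ] at e
    exact hi (by rw [← hg i, ← hg i', Subtype.ext e])
  have hβn : ∀ i i', i ≠ i' → N.gate (t i b) ∉ B (β i') := fun i i' hi hm =>
    Set.disjoint_left.1 (dBB _ _ (hββ i i' hi)) (hβg i) hm
  have n01 := hββ 0 1 (by decide)
  have n12 := hββ 1 2 (by decide)
  -- where the legs of the three sets reach the ring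
  have ne : ∀ i j i', N.pos (t i (β j)) ≠ N.pos (t i' b) := fun i j i' => hpos (hβb j)
  have s0 := fun m m' => side 1 b 2 b (β 0) (hβb 0).symm (hβb 0).symm (hβn 1 0 (by decide))
    (hβn 2 0 (by decide)) m m'
  have s1 := fun m m' => side 0 b 2 b (β 1) (hβb 1).symm (hβb 1).symm (hβn 0 1 (by decide))
    (hβn 2 1 (by decide)) m m'
  have s2 := fun m m' => side 0 b 1 b (β 2) (hβb 2).symm (hβb 2).symm (hβn 0 2 (by decide))
    (hβn 1 2 (by decide)) m m'
  simp only [inside_iff_of_lt h01, inside_iff_of_lt h12, inside_iff_of_lt h02] at s0 s1 s2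
  have x01 : N.pos (t 0 b) < N.pos (t 0 (β 1)) ∧ N.pos (t 0 (β 1)) < N.pos (t 1 b) := by
    have := s1 0 1
    have := win1 _ (hβb 1)
    have := win0 _ (hβb 1)
    have := ne 0 1 1
    omega
  have y01 : N.pos (t 0 b) < N.pos (t 1 (β 0)) ∧ N.pos (t 1 (β 0)) < N.pos (t 1 b) := by
    have := s0 1 0
    have := win1 _ (hβb 0)
    have := win0 _ (hβb 0)
    have := ne 1 0 1
    omega
  have x12 : N.pos (t 1 b) < N.pos (t 1 (β 2)) ∧ N.pos (t 1 (β 2)) < N.pos (t 2 b) := by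
    have := s2 1 2
    have := win1 _ (hβb 2)
    have := win2 _ (hβb 2)
    have := ne 1 2 1
    omega
  have y12 : N.pos (t 1 b) < N.pos (t 2 (β 1)) ∧ N.pos (t 2 (β 1)) < N.pos (t 2 b) := by
    have := s1 2 1
    have := win1 _ (hβb 1)
    have := win2 _ (hβb 1)
    have := ne 2 1 1
    omega
  have y20 : ¬ (N.pos (t 0 b) < N.pos (t 2 (β 0)) ∧ N.pos (t 2 (β 0)) < N.pos (t 2 b)) := by
    have := s0 2 0
    have := win0 _ (hβb 0)
    have := win2 _ (hβb 0)
    have := ne 2 0 1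
    omega
  have o01 := order 0 1 (β 1) (β 0) (by decide) (hβb 1) (hβb 0) n01.symm
  have o12 := order 1 2 (β 2) (β 1) (by decide) (hβb 2) (hβb 1) n12.symm
  rw [inside_iff_of_lt x01.1, inside_iff_of_lt x01.1] at o01
  rw [inside_iff_of_lt x12.1, inside_iff_of_lt x12.1] at o12
  have d01 := hpos (i := 0) (i' := 1) n01.symm
  have d12 := hpos (i := 1) (i' := 2) n12.symm
  have b1 : N.gate (t 0 (β 1)) ∈ B (β 0) := by
    by_contra hgate
    have q := side 0 (β 1) 2 b (β 0) n01.symm (hβb 0).symm hgate (hβn 2 0 (by decide)) 1 2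
    rw [inside_iff_of_lt (x01.2.trans h12), inside_iff_of_lt (x01.2.trans h12)] at q
    omega
  have b2 : N.gate (t 1 (β 2)) ∈ B (β 1) := by
    by_contra hgate
    have q := side 0 b 1 (β 2) (β 1) (hβb 1).symm n12.symm (hβn 0 1 (by decide)) hgate 0 2
    rw [inside_iff_of_lt (h01.trans x12.1), inside_iff_of_lt (h01.trans x12.1)] at q
    omega
  have q := side 0 (β 1) 1 (β 2) b (hβb 1) (hβb 2)
    (fun hm => Set.disjoint_left.1 (dBB _ _ (hβb 0)) b1 hm)
    (fun hm => Set.disjoint_left.1 (dBB _ _ (hβb 1)) b2 hm) 0 1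
  rw [inside_iff_of_lt (x01.2.trans x12.1), inside_iff_of_lt (x01.2.trans x12.1)] at q
  omega

/-- Three branch sets off the ring on one side, exactly one on the other. -/
theorem BicliqueModel.false_of_three_one
    (h : BicliqueModel N A (fun o : Option (Fin 4) => o.elim Y B))
    (hA : ∀ i, Disjoint (A i) N.ring) (hY : Disjoint Y N.ring)
    (hB : ∀ j, (B j ∩ N.ring).Nonempty) : False := by
  choose L t hL using fun (i : Fin 3) (j : Fin 4) =>
    h.exists_leg (hA i) (j := some j) (hB j)
  change ∀ i j, N.IsLeg (A i) (B j) (L i j) (t i j) at hL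
  have dAB : ∀ i j, Disjoint (A i) (B j) := fun i j => h.disj i (some j)
  have dAY : ∀ i, Disjoint (A i) Y := fun i => h.disj i none
  have dLA : ∀ i j i', Disjoint (L i j) (A i') := fun i j i' =>
    (dAB i' j).symm.mono_left (hL i j).subset
  have dLY : ∀ i j, Disjoint (L i j) Y := fun i j =>
    (h.disj_right (some j) none (by simp)).mono_left (hL i j).subset
  have dLL : ∀ i j i' j', j ≠ j' → Disjoint (L i j) (L i' j') := fun i j i' j' hj =>
    (h.disj_right (some j) (some j') (by simpa using hj)).mono (hL i j).subset (hL i' j').subset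
  have cA : ∀ i, ConnIn N.planar (A i) := fun i => h.planar_conn (hA i)
  have cY : ConnIn N.planar Y := h.symm.planar_conn (i := none) hY
  have aAY : ∀ i, ∃ u ∈ A i, ∃ v ∈ Y, N.planar.Adj u v := fun i => h.planar_adj (hA i) none
  -- for every two of the `A i`, the legs to these meet in at most one `B j`; so they are all
  -- disjoint in some `B b`
  obtain ⟨b, hb⟩ : ∃ b, ∀ i : Fin 3, Disjoint (L (i + 1) b) (L (i + 2) b) := by
    by_contra! hne
    choose f hf using hne
    obtain ⟨j, j', hj, hjj⟩ := Fintype.exists_ne_map_eq_of_card_lt f (by simp)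
    obtain ⟨l, hlj, hlj'⟩ : ∃ l : Fin 4, l ≠ j ∧ l ≠ j' := by
      clear hjj
      revert j j'
      decide
    obtain ⟨i, hi⟩ : ∃ i, i = f j := ⟨_, rfl⟩
    have m1 := hf j
    have m2 := hf j'
    rw [← hjj] at m2
    rw [← hi] at m1 m2
    have i1 : ∀ i : Fin 3, i ≠ i + 1 := by decide
    have i2 : ∀ i : Fin 3, i ≠ i + 2 := by decide
    have i3 : ∀ i : Fin 3, i + 1 ≠ i + 2 := by decide
    refine no_planar_K23 (N := N) (A := ![A (i + 1), A (i + 2)])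
      (B := ![L (i + 1) j ∪ L (i + 2) j, L (i + 1) j' ∪ L (i + 2) j', L i l ∪ A i ∪ Y])
      (π := ![t (i + 1) j, t (i + 1) j', t i l]) ?_ ?_ ?_ ?_ ?_ ?_ ?_ ?_
    · intro k
      fin_cases k
      exacts [cA _, cA _]
    · intro k
      fin_cases k
      · exact (hL _ j).conn.union_of_mem (hL _ j).conn (Set.not_disjoint_iff_nonempty_inter.1 m1)
      · exact (hL _ j').conn.union_of_mem (hL _ j').conn (Set.not_disjoint_iff_nonempty_inter.1 m2)
      · exact ((hL i l).union (cA i)).union_of_adj cY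
          ((aAY i).adj_mono Set.subset_union_right subset_rfl)
    · exact h.disj_left _ _ (i3 i)
    · intro k k' hk
      fin_cases k <;> fin_cases k' <;>
        simp [dLL _ j _ j' hj, dLL _ j' _ j hj.symm, dLL _ j _ l hlj.symm, dLL _ l _ j hlj,
          dLL _ j' _ l hlj'.symm, dLL _ l _ j' hlj', dLA, dLY, fun a b c => (dLA a b c).symm,
          fun a b => (dLY a b).symm] at hk ⊢
    · intro k k'
      fin_cases k <;> fin_cases k' <;>
        simp [fun a b c => (dLA a b c).symm, dAY, h.disj_left _ _ (i1 i).symm,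
          h.disj_left _ _ (i2 i).symm]
    · intro k
      fin_cases k
      exacts [.inl (hL _ _).mem, .inl (hL _ _).mem, .inl (.inl (hL _ _).mem)]
    · intro k
      fin_cases k
      exacts [(hL _ _).mem_ring, (hL _ _).mem_ring, (hL _ _).mem_ring]
    · intro k k'
      fin_cases k <;> fin_cases k'
      · exact (hL _ _).adj.adj_mono subset_rfl Set.subset_union_left
      · exact (hL _ _).adj.adj_mono subset_rfl Set.subset_union_left
      · exact (aAY _).adj_mono subset_rfl Set.subset_union_right
      · exact (hL _ _).adj.adj_mono subset_rfl Set.subset_union_right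
      · exact (hL _ _).adj.adj_mono subset_rfl Set.subset_union_right
      · exact (aAY _).adj_mono subset_rfl Set.subset_union_right
  have hb' : ∀ i i', i ≠ i' → Disjoint (L i b) (L i' b) := by
    intro i i' hi
    have h0 := hb 0
    have h1 := hb 1
    have h2 := hb 2
    fin_cases i <;> fin_cases i' <;>
      first | exact absurd rfl hi | exact h0 | exact h1 | exact h2 | exact h0.symm |
        exact h1.symm | exact h2.symm
  have hinj : Function.Injective fun i => N.pos (t i b) := by
    intro i i' e
    by_contra hi
    exact Set.disjoint_left.1 (hb' i i' hi) (hL i b).mem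
      (N.pos_injOn (hL i b).mem_ring (hL i' b).mem_ring e ▸ (hL i' b).mem)
  -- sort the `A i` by the positions of the legs
  obtain ⟨σ, hσ⟩ : ∃ σ : Equiv.Perm (Fin 3), StrictMono ((fun i => N.pos (t i b)) ∘ σ) :=
    ⟨_, (Tuple.monotone_sort _).strictMono_of_injective (hinj.comp (Equiv.injective _))⟩
  exact BicliqueModel.false_of_three_one_aux (A := A ∘ σ) (Y := Y) (B := B) (L := L ∘ σ)
    (t := t ∘ σ) (h.comp σ.injective Function.injective_id) (fun i => hA _) hY (fun i j => hL _ _) b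
    (fun i i' hi => hb' _ _ (σ.injective.ne hi)) (hσ (by decide : (0 : Fin 3) < 1))
    (hσ (by decide : (1 : Fin 3) < 2))

end ThreeOne
end VortexSociety

/-! ### A vortex society has no `K_{5,5}` minor -/

namespace VortexSociety

variable {V : Type*} {N : VortexSociety V} {A B : Fin 5 → Set V}

/-- At most three branch sets off the ring: merging each of them with a different branch set of the
other colour that meets the ring leaves a 5-connected minor with at least seven branch sets, all of
which meet the ring. The merging is given by `σ` and `τ`. -/
theorem BicliqueModel.false_of_merge [Finite V] (h : BicliqueModel N A B)
    (hcard : 7 ≤ Nat.card {x : Fin 5 ⊕ Fin 5 // (Sum.elim A B x ∩ N.ring).Nonempty})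
    (σ : {i // Disjoint (A i) N.ring} ↪ {j // (B j ∩ N.ring).Nonempty})
    (τ : {j // Disjoint (B j) N.ring} ↪ {i // (A i ∩ N.ring).Nonempty}) : False := by
  classical
  have off : ∀ {X : Set V}, ¬ Disjoint X N.ring → (X ∩ N.ring).Nonempty := fun h =>
    Set.not_disjoint_iff_nonempty_inter.1 h
  have on : ∀ {X : Set V}, Disjoint X N.ring → ¬ (X ∩ N.ring).Nonempty := fun h h' =>
    Set.not_disjoint_iff_nonempty_inter.2 h' h
  obtain ⟨T, hT⟩ : ∃ T : Fin 5 ⊕ Fin 5 → Set V, T = Sum.elim A B := ⟨_, rfl⟩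
  have hTl : ∀ i, T (.inl i) = A i := fun i => by rw [hT]; rfl
  have hTr : ∀ j, T (.inr j) = B j := fun j => by rw [hT]; rfl
  rw [← hT] at hcard
  have conn : ∀ x, ConnIn N.graph (T x) := by
    rintro (i | j)
    · exact hTl i ▸ h.conn_left i
    · exact hTr j ▸ h.conn_right j
  have disj : ∀ x y, x ≠ y → Disjoint (T x) (T y) := by
    rintro (i | j) (i' | j') hxy
    · exact hTl i ▸ hTl i' ▸ h.disj_left i i' (by simpa using hxy)
    · exact hTl i ▸ hTr j' ▸ h.disj i j'
    · exact hTr j ▸ hTl i' ▸ (h.disj i' j).symm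
    · exact hTr j ▸ hTr j' ▸ h.disj_right j j' (by simpa using hxy)
  have adj : ∀ i j, ∃ u ∈ T (.inl i), ∃ v ∈ T (.inr j), N.graph.Adj u v := fun i j =>
    hTl i ▸ hTr j ▸ h.adj i j
  have adj' : ∀ i j, ∃ u ∈ T (.inr j), ∃ v ∈ T (.inl i), N.graph.Adj u v := fun i j =>
    hTl i ▸ hTr j ▸ h.symm.adj j i
  -- `rep x` is the branch set into which `x` is merged
  obtain ⟨rep, rep_self, rep_adj, repl, repr⟩ :
      ∃ rep : Fin 5 ⊕ Fin 5 → {x : Fin 5 ⊕ Fin 5 // (T x ∩ N.ring).Nonempty},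
        (∀ x : {x : Fin 5 ⊕ Fin 5 // (T x ∩ N.ring).Nonempty}, rep x = x) ∧
        (∀ x, x ≠ rep x → ∃ u ∈ T x, ∃ v ∈ T (rep x), N.graph.Adj u v) ∧
        (Function.Injective fun i => rep (.inl i)) ∧
        (Function.Injective fun j => rep (.inr j)) := by
    let fl : ∀ i, {x : Fin 5 ⊕ Fin 5 // (T x ∩ N.ring).Nonempty} := fun i =>
      if hi : Disjoint (A i) N.ring then ⟨.inr (σ ⟨i, hi⟩), by rw [hTr]; exact (σ ⟨i, hi⟩).2⟩
      else ⟨.inl i, by rw [hTl]; exact off hi⟩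
    let fr : ∀ j, {x : Fin 5 ⊕ Fin 5 // (T x ∩ N.ring).Nonempty} := fun j =>
      if hj : Disjoint (B j) N.ring then ⟨.inl (τ ⟨j, hj⟩), by rw [hTl]; exact (τ ⟨j, hj⟩).2⟩
      else ⟨.inr j, by rw [hTr]; exact off hj⟩
    refine ⟨Sum.elim fl fr, ?_, ?_, ?_, ?_⟩
    · rintro ⟨i | j, hx⟩
      · have : ¬ Disjoint (A i) N.ring := fun hd => on hd (hTl i ▸ hx)
        simp [fl, this]
      · have : ¬ Disjoint (B j) N.ring := fun hd => on hd (hTr j ▸ hx)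
        simp [fr, this]
    · rintro (i | j) hx
      · by_cases hi : Disjoint (A i) N.ring
        · have : ((Sum.elim fl fr (.inl i) : {x : Fin 5 ⊕ Fin 5 // (T x ∩ N.ring).Nonempty}) :
              Fin 5 ⊕ Fin 5) = .inr (σ ⟨i, hi⟩) := by simp [fl, hi]
          rw [this]
          exact adj _ _
        · exact absurd (by simp [fl, hi]) hx
      · by_cases hj : Disjoint (B j) N.ring
        · have : ((Sum.elim fl fr (.inr j) : {x : Fin 5 ⊕ Fin 5 // (T x ∩ N.ring).Nonempty}) :
              Fin 5 ⊕ Fin 5) = .inl (τ ⟨j, hj⟩) := by simp [fr, hj]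
          rw [this]
          exact adj' _ _
        · exact absurd (by simp [fr, hj]) hx
    · intro i i' hii
      by_cases hi : Disjoint (A i) N.ring <;> by_cases hi' : Disjoint (A i') N.ring
      · have : σ ⟨i, hi⟩ = σ ⟨i', hi'⟩ := Subtype.ext (by simpa [fl, hi, hi'] using hii)
        simpa using σ.injective this
      · simp [fl, hi, hi'] at hii
      · simp [fl, hi, hi'] at hii
      · simpa [fl, hi, hi'] using hii
    · intro j j' hjj
      by_cases hj : Disjoint (B j) N.ring <;> by_cases hj' : Disjoint (B j') N.ring
      · have : τ ⟨j, hj⟩ = τ ⟨j', hj'⟩ := Subtype.ext (by simpa [fr, hj, hj'] using hjj)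
        simpa using τ.injective this
      · simp [fr, hj, hj'] at hjj
      · simp [fr, hj, hj'] at hjj
      · simpa [fr, hj, hj'] using hjj
  let U : {x : Fin 5 ⊕ Fin 5 // (T x ∩ N.ring).Nonempty} → Set V := fun r =>
    {v | ∃ x, rep x = r ∧ v ∈ T x}
  have hTU : ∀ x, T x ⊆ U (rep x) := fun x v hv => ⟨x, rfl, hv⟩
  have hrU : ∀ r : {x : Fin 5 ⊕ Fin 5 // (T x ∩ N.ring).Nonempty}, T r ⊆ U r := fun r v hv =>
    ⟨r, rep_self r, hv⟩
  have near : ∀ i j, rep (.inl i) = rep (.inr j) ∨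
      ∃ u ∈ U (rep (.inl i)), ∃ v ∈ U (rep (.inr j)), N.graph.Adj u v := fun i j =>
    .inr ((adj i j).adj_mono (hTU _) (hTU _))
  have near' : ∀ i j, rep (.inr j) = rep (.inl i) ∨
      ∃ u ∈ U (rep (.inr j)), ∃ v ∈ U (rep (.inl i)), N.graph.Adj u v := fun i j =>
    .inr ((adj' i j).adj_mono (hTU _) (hTU _))
  -- an injective family of five representatives is not contained in a set of four
  have five : ∀ f : Fin 5 → {x : Fin 5 ⊕ Fin 5 // (T x ∩ N.ring).Nonempty}, Function.Injective f →
      ∀ S : Finset {x : Fin 5 ⊕ Fin 5 // (T x ∩ N.ring).Nonempty}, S.card ≤ 4 →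
        ∃ k, f k ∉ S := by
    intro f hf S hS
    by_contra! hall
    have := Finset.card_le_card_of_injOn f (s := Finset.univ) (t := S) (fun k _ => hall k)
      hf.injOn
    rw [Finset.card_univ, Fintype.card_fin] at this
    omega
  refine no_model_on_ring (N := N) (U := U) ?_ ?_ (fun r => ?_)
    (Nat.card_eq_fintype_card (α := {x : Fin 5 ⊕ Fin 5 // (T x ∩ N.ring).Nonempty}) ▸ hcard) ?_
  · intro r r' hr
    rw [Set.disjoint_left]
    rintro v ⟨x, hx, hv⟩ ⟨x', hx', hv'⟩
    refine Set.disjoint_left.1 (disj x x' fun e => hr ?_) hv hv'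
    rw [← hx, ← hx', e]
  · intro r
    have key : ∀ a ∈ U r, ∀ c ∈ T r, ReachIn N.graph (U r) a c := by
      rintro a ⟨x, rfl, ha⟩ c hc
      by_cases hx : x = rep x
      · exact (conn _ a (hx ▸ ha) c hc).mono (hrU _)
      · obtain ⟨u, hu, v, hv, huv⟩ := rep_adj x hx
        exact ((conn x a ha u hu).mono (hTU x)).trans
          ((ReachIn.of_adj huv (hTU x hu) (hrU _ hv)).trans ((conn _ v hv c hc).mono (hrU _)))
    obtain ⟨c, hc, -⟩ := r.2
    exact fun a ha b hb => (key a ha c hc).trans (key b hb c hc).symm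
  · obtain ⟨v, hv, hvr⟩ := r.2
    exact ⟨v, hrU r hv, hvr⟩
  · intro S hS r r' hr hr'
    obtain ⟨x, rfl⟩ : ∃ x, rep x = r := ⟨r, rep_self r⟩
    obtain ⟨y, rfl⟩ : ∃ y, rep y = r' := ⟨r', rep_self r'⟩
    rcases x with i | j <;> rcases y with i' | j'
    · obtain ⟨k, hk⟩ := five _ repr S hS
      exact ⟨_, hk, near _ _, near' _ _⟩
    · exact ⟨_, hr', near _ _, .inl rfl⟩
    · exact ⟨_, hr', near' _ _, .inl rfl⟩
    · obtain ⟨k, hk⟩ := five _ repl S hS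
      exact ⟨_, hk, near' _ _, near _ _⟩

/-- An injection whose values satisfy a predicate, from a lower bound on their number. -/
theorem exists_injective_of_le_card {n k : ℕ} {P : Fin n → Prop} (h : k ≤ Nat.card {i // P i}) :
    ∃ f : Fin k → Fin n, Function.Injective f ∧ ∀ i, P (f i) := by
  classical
  rw [Nat.card_eq_fintype_card] at h
  obtain ⟨f⟩ := Function.Embedding.nonempty_of_card_le (α := Fin k) (β := {i // P i})
    (by simpa using h)
  exact ⟨fun i => f i, fun i j hij => f.injective (Subtype.ext hij), fun i => (f i).2⟩

/-- The case analysis, by the number of branch sets of either colour that avoid the ring, when there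
are at least as many on the left. -/
theorem BicliqueModel.false_of_le [Finite V] (h : BicliqueModel N A B)
    (hle : Nat.card {j // Disjoint (B j) N.ring} ≤ Nat.card {i // Disjoint (A i) N.ring}) :
    False := by
  classical
  have compl : ∀ C : Fin 5 → Set V, Nat.card {i // Disjoint (C i) N.ring} +
      Nat.card {i // (C i ∩ N.ring).Nonempty} = 5 := by
    intro C
    have e : ∀ i, (C i ∩ N.ring).Nonempty ↔ ¬ Disjoint (C i) N.ring := fun i =>
      Set.not_disjoint_iff_nonempty_inter.symm
    simp only [e, Nat.card_eq_fintype_card]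
    have := Fintype.card_subtype_compl fun i => Disjoint (C i) N.ring
    have h' := Fintype.card_subtype_le fun i => Disjoint (C i) N.ring
    rw [Fintype.card_fin] at this h'
    omega
  have cA := compl A
  have cB := compl B
  have inj_sum : ∀ {k l : ℕ} {C : Fin 5 → Set V} {f : Fin k → Fin 5} {g : Fin l → Fin 5},
      Function.Injective f → Function.Injective g → (∀ i, Disjoint (C (f i)) N.ring) →
      (∀ i, (C (g i) ∩ N.ring).Nonempty) → Function.Injective (Sum.elim f g) := by
    intro k l C f g hf hg hf' hg'
    refine hf.sumElim hg fun i j e => ?_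
    have := hg' j
    rw [← e] at this
    exact Set.not_disjoint_iff_nonempty_inter.2 this (hf' i)
  by_cases hsum : Nat.card {i // Disjoint (A i) N.ring} +
      Nat.card {j // Disjoint (B j) N.ring} ≤ 3
  · have hσ : Nonempty ({i // Disjoint (A i) N.ring} ↪ {j // (B j ∩ N.ring).Nonempty}) :=
      Function.Embedding.nonempty_of_card_le (by
        rw [← Nat.card_eq_fintype_card, ← Nat.card_eq_fintype_card]; omega)
    have hτ : Nonempty ({j // Disjoint (B j) N.ring} ↪ {i // (A i ∩ N.ring).Nonempty}) :=
      Function.Embedding.nonempty_of_card_le (by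
        rw [← Nat.card_eq_fintype_card, ← Nat.card_eq_fintype_card]; omega)
    obtain ⟨σ⟩ := hσ
    obtain ⟨τ⟩ := hτ
    refine h.false_of_merge ?_ σ τ
    have := Nat.card_congr
      (Equiv.subtypeSum (p := fun x : Fin 5 ⊕ Fin 5 => (Sum.elim A B x ∩ N.ring).Nonempty))
    rw [this, Nat.card_sum]
    simp only [Sum.elim_inl, Sum.elim_inr]
    omega
  by_cases h3 : 3 ≤ Nat.card {i // Disjoint (A i) N.ring}
  · obtain ⟨f, hf, hfA⟩ := exists_injective_of_le_card h3
    by_cases h3' : 3 ≤ Nat.card {j // Disjoint (B j) N.ring}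
    · obtain ⟨g, hg, hgB⟩ := exists_injective_of_le_card h3'
      exact (h.comp hf hg).false_of_three_three hfA hgB
    by_cases h2 : 2 ≤ Nat.card {j // Disjoint (B j) N.ring}
    · obtain ⟨g, hg, hgB⟩ := exists_injective_of_le_card h2
      obtain ⟨g', hg', hgB'⟩ := exists_injective_of_le_card
        (show 3 ≤ Nat.card {j // (B j ∩ N.ring).Nonempty} by omega)
      exact (h.comp hf (inj_sum hg hg' hgB hgB')).false_of_three_two hfA hgB hgB'
    by_cases h1 : 1 ≤ Nat.card {j // Disjoint (B j) N.ring}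
    · obtain ⟨g, hg, hgB⟩ := exists_injective_of_le_card h1
      obtain ⟨g', hg', hgB'⟩ := exists_injective_of_le_card
        (show 4 ≤ Nat.card {j // (B j ∩ N.ring).Nonempty} by omega)
      have hi : Function.Injective (fun o : Option (Fin 4) => o.elim (g 0) g') := by
        have := (inj_sum hg hg' hgB hgB').comp (f := fun o : Option (Fin 4) =>
          o.elim (Sum.inl (0 : Fin 1)) Sum.inr) (by
            rintro (_ | a) (_ | b) <;> simp)
        convert this using 1
        ext (_ | a) <;> rfl
      have hm := h.comp hf hi
      have e : B ∘ (fun o : Option (Fin 4) => o.elim (g 0) g') =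
          fun o => o.elim (B (g 0)) (B ∘ g') := by
        ext (_ | a) <;> rfl
      rw [e] at hm
      exact hm.false_of_three_one hfA (hgB 0) hgB'
    · obtain ⟨f, hf, hfA⟩ := exists_injective_of_le_card
        (show 2 ≤ Nat.card {i // Disjoint (A i) N.ring} by omega)
      obtain ⟨g, hg, hgB⟩ := exists_injective_of_le_card
        (show 5 ≤ Nat.card {j // (B j ∩ N.ring).Nonempty} by omega)
      exact (h.comp hf hg).false_of_two_zero hfA hgB
  · obtain ⟨f, hf, hfA⟩ := exists_injective_of_le_card
      (show 2 ≤ Nat.card {i // Disjoint (A i) N.ring} by omega)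
    obtain ⟨f', hf', hfA'⟩ := exists_injective_of_le_card
      (show 2 ≤ Nat.card {i // (A i ∩ N.ring).Nonempty} by omega)
    obtain ⟨g, hg, hgB⟩ := exists_injective_of_le_card
      (show 2 ≤ Nat.card {j // Disjoint (B j) N.ring} by omega)
    obtain ⟨g', hg', hgB'⟩ := exists_injective_of_le_card
      (show 3 ≤ Nat.card {j // (B j ∩ N.ring).Nonempty} by omega)
    exact (h.comp (inj_sum hf hf' hfA hfA') (inj_sum hg hg' hgB hgB')).false_of_two_two
      hfA hfA' hgB hgB'

/-- The graph of a vortex society has no `K_{5,5}` minor. -/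
theorem not_hasMinor_K55 [Finite V] (N : VortexSociety V) :
    ¬ HasMinor (completeBipartiteGraph (Fin 5) (Fin 5)) N.graph := by
  rintro ⟨T, -, hT, hd, ha⟩
  have h : BicliqueModel N (fun i : Fin 5 => T (.inl i)) (fun j : Fin 5 => T (.inr j)) :=
    ⟨fun i => hT _, fun j => hT _, fun i i' hi => hd _ _ (by simpa using hi),
      fun j j' hj => hd _ _ (by simpa using hj), fun i j => hd _ _ (by simp),
      fun i j => ha _ _ (by simp)⟩
  rcases le_total (Nat.card {j : Fin 5 // Disjoint (T (.inr j)) N.ring})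
    (Nat.card {i : Fin 5 // Disjoint (T (.inl i)) N.ring}) with hle | hle
  · exact h.false_of_le hle
  · exact h.symm.false_of_le hle

end VortexSociety

/-! ### The shallow vortex matching grid as a vortex society -/

section Grid

/-- The clockwise planar edges of the grid with cycles of length `n`, in coordinates: the cycle
edges and the edges between consecutive cycles. -/
def GridStep (n i j i' j' : ℕ) : Prop :=
  (i' = i ∧ j' = (j + 1) % n) ∨ (i' = i + 1 ∧ j % 4 = 0 ∧ j' = j + 1) ∨
    (i = i' + 1 ∧ j % 4 = 2 ∧ j' = j + 1)

/-- In the drawing of the grid in a half-plane, the vertex `(i, j)` has abscissa `j`, slightly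
increased with `i`, and ordinate `i`. -/
def gridLeft (i j i' j' : ℕ) : ZMod 2 :=
  if j' < j ∨ j' = j ∧ i' < i then 1 else 0

/-- The parity of the number of crossings of the upward ray from `(a, b)` with a clockwise planar
edge from `(i, j)` to `(i', j')`. The edges that close up the cycles leave to the right, run back
above everything else, and arrive from the left. Such an edge has `j' < j` and crosses every ray, a
second time if it arrives at abscissa `b` above `(a, b)`. The first end contributes nothing, because
the vertices `(a, j)` to the right of `(i, j)` have `a > i` and so lie above the edge. -/
def gridCross (a b j i' j' : ℕ) : ZMod 2 :=
  (if j' = b ∧ a < i' then 1 else 0) + (if j' < j then 1 else 0)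

theorem GridStep.cases {n i j i' j' : ℕ} (h : GridStep n i j i' j') (hj : j < n) :
    (j' = j + 1 ∧ (i' = i ∨ i' = i + 1 ∧ j % 4 = 0 ∨ i = i' + 1 ∧ j % 4 = 2)) ∨
      (j + 1 = n ∧ j' = 0 ∧ i' = i) := by
  rcases h with ⟨h1, h2⟩ | ⟨h1, h2, h3⟩ | ⟨h1, h2, h3⟩
  · rcases Nat.lt_or_ge (j + 1) n with h | h
    · rw [Nat.mod_eq_of_lt h] at h2
      exact .inl ⟨h2, .inl h1⟩
    · have : j + 1 = n := by omega
      rw [this, Nat.mod_self] at h2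
      exact .inr ⟨this, h2, h1⟩
  · exact .inl ⟨h3, .inr (.inl ⟨h1, h2⟩)⟩
  · exact .inl ⟨h3, .inr (.inr ⟨h1, h2⟩)⟩

theorem gridStep_crossing {n i j i' j' a b a' b' : ℕ} (hn : 8 ≤ n) (hj : j < n) (hj' : j' < n)
    (hb : b < n) (hb' : b' < n) (h : GridStep n i j i' j') (h' : GridStep n a b a' b')
    (h1 : ¬ (i = a ∧ j = b)) (h2 : ¬ (i = a' ∧ j = b')) (h3 : ¬ (i' = a ∧ j' = b))
    (h4 : ¬ (i' = a' ∧ j' = b')) :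
    (gridCross i j b a' b' + gridCross i' j' b a' b') + (gridCross a b j i' j' +
      gridCross a' b' j i' j') + (gridLeft a b i j + gridLeft a b i' j') +
      (gridLeft a' b' i j + gridLeft a' b' i' j') = 0 := by
  have two : (1 + 1 : ZMod 2) = 0 := by decide
  unfold gridCross gridLeft
  rcases h.cases hj with ⟨e, hi⟩ | ⟨e, e', hi⟩ <;> rcases h'.cases hb with ⟨f, ha⟩ | ⟨f, f', ha⟩
  · rcases Nat.lt_trichotomy j b with hjb | hjb | hjb
    · rcases Nat.lt_or_ge (j + 1) b with hjb | hjb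
      · simp (disch := omega) only [if_pos, if_neg]
        decide
      · rcases Nat.lt_or_gt_of_ne (show i' ≠ a by omega) with hc | hc
        all_goals
          simp (disch := omega) only [if_pos, if_neg]
          decide
    · rcases Nat.lt_or_gt_of_ne (show i ≠ a by omega) with hc | hc
      all_goals
        simp (disch := omega) only [if_pos, if_neg]
        decide
    · rcases Nat.lt_or_ge (b + 1) j with hjb | hjb
      · simp (disch := omega) only [if_neg]
        decide
      · rcases Nat.lt_or_gt_of_ne (show a' ≠ i by omega) with hc | hc
        all_goals
          simp (disch := omega) only [if_pos, if_neg]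
          decide
  · rcases Nat.eq_or_lt_of_le (show 0 ≤ j by omega) with hz | hz
    · rcases Nat.lt_or_gt_of_ne (show i ≠ a by omega) with hc | hc
      all_goals
        simp (disch := omega) only [if_pos, if_neg]
        decide
    · rcases Nat.eq_or_lt_of_le (show j' ≤ b by omega) with hy | hy
      · rcases Nat.lt_or_gt_of_ne (show i' ≠ a by omega) with hc | hc
        all_goals
          simp (disch := omega) only [if_pos, if_neg]
          decide
      · simp (disch := omega) only [if_pos, if_neg]
        decide
  · rcases Nat.eq_or_lt_of_le (show 0 ≤ b by omega) with hz | hz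
    · rcases Nat.lt_or_gt_of_ne (show i ≠ a by omega) with hc | hc
      all_goals
        simp (disch := omega) only [if_pos, if_neg]
        decide
    · rcases Nat.eq_or_lt_of_le (show b' ≤ j by omega) with hy | hy
      · rcases Nat.lt_or_gt_of_ne (show i ≠ a' by omega) with hc | hc
        all_goals
          simp (disch := omega) only [if_pos, if_neg]
          decide
      · simp (disch := omega) only [if_pos, if_neg]
        decide
  · rcases Nat.lt_or_gt_of_ne (show i ≠ a by omega) with hc | hc
    all_goals
      simp (disch := omega) only [if_pos, if_neg]
      decide

theorem gridStep_ring {n i j i' j' b : ℕ} (hn : 8 ≤ n) (hj : j < n) (hb : b < n)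
    (h : GridStep n i j i' j') (h2 : ¬ (0 = i' ∧ b = j')) :
    gridCross 0 b j i' j' = gridLeft 0 b i j + gridLeft 0 b i' j' := by
  have two : (1 + 1 : ZMod 2) = 0 := by decide
  unfold gridCross gridLeft
  rcases h.cases hj with ⟨e, hi⟩ | ⟨e, e', hi⟩
  · rcases Nat.lt_trichotomy j b with hjb | hjb | hjb
    · rcases Nat.lt_or_ge (j + 1) b with hjb | hjb
      all_goals simp (disch := omega) only [if_pos, if_neg, two, add_zero]
    · simp (disch := omega) only [if_neg, add_zero]
    · simp (disch := omega) only [if_neg, add_zero]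
  · rcases Nat.eq_or_lt_of_le (show 0 ≤ b by omega) with hz | hz
    · simp (disch := omega) only [if_pos, if_neg, zero_add]
      exact two.symm
    · simp (disch := omega) only [if_pos, if_neg, zero_add]

variable (k : ℕ)

/-- The grid without the crossing edges on its first cycle. -/
def planarGrid : SimpleGraph (Fin (2 * k) × Fin (8 * k)) :=
  SimpleGraph.fromRel fun a b => GridStep (8 * k) a.1 a.2 b.1 b.2

/-- The position of the first end of the crossing edge that passes over position `j`. An edge that
starts at `a`, where `a % 4 = 1`, passes over `a + 1` to `a + 4`; the last one, which starts at
`8 * k - 3`, passes over the positions `0` and `1`. -/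
def gridGate (j : ℕ) : ℕ :=
  if 2 ≤ j then (j - 2) / 4 * 4 + 1 else 8 * k - 3

variable {k}

theorem planarGrid_adj {u v : Fin (2 * k) × Fin (8 * k)} : (planarGrid k).Adj u v ↔ u ≠ v ∧
    (GridStep (8 * k) u.1 u.2 v.1 v.2 ∨ GridStep (8 * k) v.1 v.2 u.1 u.2) :=
  SimpleGraph.fromRel_adj _ _ _

theorem planarGrid_le : planarGrid k ≤ shallowVortexMatchingGrid k := by
  intro u v h
  obtain ⟨hne, h⟩ := planarGrid_adj.1 h
  refine (SimpleGraph.fromRel_adj _ _ _).2 ⟨hne, h.imp ?_ ?_⟩ <;>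
  · rintro (⟨h1, h2⟩ | h | h)
    · exact .inl ⟨Fin.ext h1, h2⟩
    · exact .inr (.inl h)
    · exact .inr (.inr (.inl h))

/-- The edges of the grid that are not planar are the crossing edges on the first cycle. -/
theorem grid_adj_cases {u v : Fin (2 * k) × Fin (8 * k)}
    (h : (shallowVortexMatchingGrid k).Adj u v) (h' : ¬ (planarGrid k).Adj u v) :
    (u.1 : ℕ) = 0 ∧ (v.1 : ℕ) = 0 ∧
      (((u.2 : ℕ) % 4 = 1 ∧ (v.2 : ℕ) = ((u.2 : ℕ) + 5) % (8 * k)) ∨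
        ((v.2 : ℕ) % 4 = 1 ∧ (u.2 : ℕ) = ((v.2 : ℕ) + 5) % (8 * k))) := by
  obtain ⟨hne, h⟩ := (SimpleGraph.fromRel_adj _ _ _).1 h
  rw [planarGrid_adj] at h'
  push Not at h'
  obtain ⟨h1, h2⟩ := h' hne
  rcases h with (⟨e, e'⟩ | h | h | h) | (⟨e, e'⟩ | h | h | h)
  · exact absurd (.inl ⟨congrArg Fin.val e, e'⟩) h1
  · exact absurd (.inr (.inl h)) h1
  · exact absurd (.inr (.inr h)) h1
  · exact ⟨h.1, h.2.1, .inl h.2.2⟩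
  · exact absurd (.inl ⟨congrArg Fin.val e, e'⟩) h2
  · exact absurd (.inr (.inl h)) h2
  · exact absurd (.inr (.inr h)) h2
  · exact ⟨h.2.1, h.1, .inr h.2.2⟩

theorem gridGate_chord {a b x y : ℕ} (ha : a < 8 * k) (hx : x < 8 * k)
    (hy : y < 8 * k) (h4 : a % 4 = 1) (hb : b = (a + 5) % (8 * k)) (hax : a ≠ x) (hay : a ≠ y)
    (hbx : b ≠ x) (hby : b ≠ y) (hgx : gridGate k x ≠ a) (hgy : gridGate k y ≠ a) :
    (x < a ∧ a < y ∨ y < a ∧ a < x) ↔ (x < b ∧ b < y ∨ y < b ∧ b < x) := by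
  unfold gridGate at hgx hgy
  rcases Nat.lt_or_ge (a + 5) (8 * k) with h | h
  · rw [Nat.mod_eq_of_lt h] at hb
    have key : ∀ z, a ≠ z → b ≠ z → (if 2 ≤ z then (z - 2) / 4 * 4 + 1 else 8 * k - 3) ≠ a →
        (z < a ∧ z < b ∨ a < z ∧ b < z) := by
      intro z h1 h2 h3
      split_ifs at h3 <;> omega
    have h1 := key x hax hbx hgx
    have h2 := key y hay hby hgy
    omega
  · rw [Nat.mod_eq_sub_mod h, Nat.mod_eq_of_lt (by omega)] at hb
    have key : ∀ z, z < 8 * k → a ≠ z → b ≠ z →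
        (if 2 ≤ z then (z - 2) / 4 * 4 + 1 else 8 * k - 3) ≠ a → z < a ∧ b < z := by
      intro z h0 h1 h2 h3
      split_ifs at h3 <;> omega
    have h1 := key x hx hax hbx hgx
    have h2 := key y hy hay hby hgy
    omega

theorem gridGate_lt (hk : 0 < k) {j : ℕ} (hj : j < 8 * k) : gridGate k j < 8 * k := by
  unfold gridGate
  split_ifs <;> omega

/-- `gridCross` for an edge that is given by its ends in any order. -/
def gridEdgeCross (v u u' : Fin (2 * k) × Fin (8 * k)) : ZMod 2 :=
  if (u'.2 : ℕ) = (u.2 + 1) % (8 * k) then gridCross v.1 v.2 u.2 u'.1 u'.2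
    else gridCross v.1 v.2 u'.2 u.1 u.2

theorem GridStep.snd_eq {n i j i' j' : ℕ} (h : GridStep n i j i' j') (hj' : j' < n) :
    j' = (j + 1) % n := by
  rcases h with ⟨-, h⟩ | ⟨-, -, h⟩ | ⟨-, -, h⟩
  · exact h
  · rw [← h, Nat.mod_eq_of_lt hj']
  · rw [← h, Nat.mod_eq_of_lt hj']

theorem gridEdgeCross_of_gridStep {u u' : Fin (2 * k) × Fin (8 * k)}
    (h : GridStep (8 * k) u.1 u.2 u'.1 u'.2) (v : Fin (2 * k) × Fin (8 * k)) :
    gridEdgeCross v u u' = gridCross v.1 v.2 u.2 u'.1 u'.2 :=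
  if_pos (h.snd_eq u'.2.2)

theorem gridEdgeCross_comm {u u' : Fin (2 * k) × Fin (8 * k)}
    (h : GridStep (8 * k) u.1 u.2 u'.1 u'.2) (v : Fin (2 * k) × Fin (8 * k)) :
    gridEdgeCross v u' u = gridEdgeCross v u u' := by
  rw [gridEdgeCross_of_gridStep h]
  refine if_neg fun h' => ?_
  have hu := u.2.2
  have hu' := u'.2.2
  rcases h.cases hu with h1 | h1
  · rcases Nat.lt_or_ge (u'.2 + 1) (8 * k) with h2 | h2
    · rw [Nat.mod_eq_of_lt h2] at h'
      omega
    · have h3 : (u'.2 : ℕ) + 1 = 8 * k := by omega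
      rw [h3, Nat.mod_self] at h'
      omega
  · rw [h1.2.1, Nat.mod_eq_of_lt (by omega)] at h'
    omega

theorem ne_coords {u v : Fin (2 * k) × Fin (8 * k)} (h : u ≠ v) :
    ¬ ((u.1 : ℕ) = v.1 ∧ (u.2 : ℕ) = v.2) :=
  fun e => h (Prod.ext (Fin.ext e.1) (Fin.ext e.2))

theorem gridEdgeCross_crossing {u u' x x' : Fin (2 * k) × Fin (8 * k)}
    (h : GridStep (8 * k) u.1 u.2 u'.1 u'.2) (h' : GridStep (8 * k) x.1 x.2 x'.1 x'.2)
    (h1 : u ≠ x) (h2 : u ≠ x') (h3 : u' ≠ x) (h4 : u' ≠ x') :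
    (gridEdgeCross u x x' + gridEdgeCross u' x x') + (gridEdgeCross x u u' +
      gridEdgeCross x' u u') + (gridLeft x.1 x.2 u.1 u.2 + gridLeft x.1 x.2 u'.1 u'.2) +
      (gridLeft x'.1 x'.2 u.1 u.2 + gridLeft x'.1 x'.2 u'.1 u'.2) = 0 := by
  simp only [gridEdgeCross_of_gridStep h, gridEdgeCross_of_gridStep h']
  have := u.2.2
  exact gridStep_crossing (by omega) u.2.2 u'.2.2 x.2.2 x'.2.2 h h' (ne_coords h1) (ne_coords h2)
    (ne_coords h3) (ne_coords h4)

theorem gridEdgeCross_ring {v u u' : Fin (2 * k) × Fin (8 * k)} (hv : (v.1 : ℕ) = 0)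
    (h : GridStep (8 * k) u.1 u.2 u'.1 u'.2) (h2 : v ≠ u') :
    gridEdgeCross v u u' = gridLeft v.1 v.2 u.1 u.2 + gridLeft v.1 v.2 u'.1 u'.2 := by
  rw [gridEdgeCross_of_gridStep h]
  have h2' := ne_coords h2
  rw [hv] at h2' ⊢
  have := u.2.2
  exact gridStep_ring (by omega) u.2.2 v.2.2 h h2'

/-- The shallow vortex matching grid as a vortex society. The ring is the first cycle, cut open
between its last and its first vertex. -/
def gridSociety (hk : 0 < k) : VortexSociety (Fin (2 * k) × Fin (8 * k)) where
  graph := shallowVortexMatchingGrid k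
  planar := planarGrid k
  planar_le := planarGrid_le
  ring := {v | (v.1 : ℕ) = 0}
  pos v := v.2
  pos_injOn := fun u hu v hv h => Prod.ext (Fin.ext (Eq.trans hu (Eq.symm hv))) (Fin.ext h)
  gate v := (⟨0, by omega⟩, ⟨gridGate k v.2, gridGate_lt hk v.2.2⟩)
  left u v := gridLeft u.1 u.2 v.1 v.2
  cross := gridEdgeCross
  left_add := by
    intro u v h
    have := ne_coords h
    unfold gridLeft
    by_cases h' : (v.2 : ℕ) < u.2 ∨ (v.2 : ℕ) = u.2 ∧ (v.1 : ℕ) < u.1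
    · rw [if_pos h', if_neg (by omega), add_zero]
    · rw [if_neg h', if_pos (by omega), zero_add]
  left_ring := by
    intro u hu v hv
    simp only [Set.mem_ofPred_eq] at hu hv
    simp [gridLeft, hu, hv]
  crossing := by
    intro u u' x x' h h' h1 h2 h3 h4
    rcases (planarGrid_adj.1 h).2 with h | h <;> rcases (planarGrid_adj.1 h').2 with h' | h'
    · exact gridEdgeCross_crossing h h' h1 h2 h3 h4
    · rw [gridEdgeCross_comm h', gridEdgeCross_comm h']
      linear_combination gridEdgeCross_crossing h h' h2 h1 h4 h3
    · rw [gridEdgeCross_comm h, gridEdgeCross_comm h]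
      linear_combination gridEdgeCross_crossing h h' h3 h4 h1 h2
    · rw [gridEdgeCross_comm h', gridEdgeCross_comm h', gridEdgeCross_comm h,
        gridEdgeCross_comm h]
      linear_combination gridEdgeCross_crossing h h' h4 h3 h2 h1
  ring_cross := by
    intro v hv u u' h h1 h2
    rcases (planarGrid_adj.1 h).2 with h | h
    · exact gridEdgeCross_ring hv h h2
    · rw [gridEdgeCross_comm h, gridEdgeCross_ring hv h h1, add_comm]
  chord := by
    intro u v h h'
    obtain ⟨hu, hv, h⟩ := grid_adj_cases h h'
    have ne {a b : Fin (2 * k) × Fin (8 * k)} (ha : (a.1 : ℕ) = 0) (hb : (b.1 : ℕ) = 0)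
        (h : a ≠ b) : (a.2 : ℕ) ≠ b.2 :=
      fun e => ne_coords h ⟨ha.trans hb.symm, e⟩
    refine ⟨hu, hv, fun x hx y hy h1 h2 h3 h4 h5 h6 h7 h8 => ?_⟩
    rcases h with ⟨h0, h⟩ | ⟨h0, h⟩
    · exact gridGate_chord u.2.2 x.2.2 y.2.2 h0 h (ne hu hx h1) (ne hu hy h2) (ne hv hx h3)
        (ne hv hy h4) (ne rfl hu h5) (ne rfl hu h7)
    · exact (gridGate_chord v.2.2 x.2.2 y.2.2 h0 h (ne hv hx h3) (ne hv hy h4) (ne hu hx h1)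
        (ne hu hy h2) (ne rfl hv h6) (ne rfl hv h8)).symm

end Grid

/-! ### Matching minors of the shallow vortex matching grid -/

theorem not_hasMinor_K55_shallowVortexMatchingGrid (k : ℕ) :
    ¬ HasMinor (completeBipartiteGraph (Fin 5) (Fin 5)) (shallowVortexMatchingGrid k) := by
  rcases Nat.eq_zero_or_pos k with rfl | hk
  · rintro ⟨T, hT, -⟩
    obtain ⟨v, -⟩ := hT (.inl 0)
    exact absurd v.1.2 (by omega)
  · exact (gridSociety hk).not_hasMinor_K55

theorem hasMinor_completeBipartiteGraph_of_le {s t : ℕ} (h : s ≤ t) :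
    HasMinor (completeBipartiteGraph (Fin s) (Fin s)) (completeBipartiteGraph (Fin t) (Fin t)) :=
  .of_hom ⟨Sum.map (Fin.castLE h) (Fin.castLE h), by
    rintro (a | a) (b | b) <;> simp⟩
    (Sum.map_injective.2 ⟨Fin.castLE_injective h, Fin.castLE_injective h⟩)

/-- The empty graph `K_{0,0}` is a matching minor of every graph with a perfect matching. -/
theorem zero_mem_bicliqueMatchingMinorOrders {V : Type*} {B : SimpleGraph V} {M : B.Subgraph}
    (hM : M.IsPerfectMatching) : 0 ∈ bicliqueMatchingMinorOrders B := by
  refine ⟨⊥, ⟨⟨Set.univ, fun a b => M.Adj a b, fun h => M.adj_sub h, fun _ => Set.mem_univ _,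
    ⟨fun _ _ h => M.symm.symm _ _ h⟩⟩, fun v _ => ?_, fun _ => Set.mem_univ _⟩, ?_⟩
  · obtain ⟨w, hw, hw'⟩ := hM.1 (hM.2 v)
    exact ⟨⟨w, by simp⟩, hw, fun y hy => Subtype.ext (hw' y hy)⟩
  · have : IsEmpty (⊥ : B.Subgraph).verts := by simp
    exact .iso _ ⟨Equiv.equivOfIsEmpty _ _, fun {a} => isEmptyElim a⟩

/-- A shallow vortex matching minor without an edge would be `K₁`, but bicontractions and the
deletion of a conformal complement preserve the parity of the number of vertices. -/
theorem IsShallowVortexMatchingMinor.exists_isPerfectMatching {V : Type*} {B : SimpleGraph V}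
    (h : IsShallowVortexMatchingMinor B) : ∃ M : B.Subgraph, M.IsPerfectMatching := by
  obtain ⟨-, ⟨hc, he⟩, k, hk⟩ := h
  by_cases hB : ∃ u v, B.Adj u v
  · obtain ⟨u, v, huv⟩ := hB
    obtain ⟨M, hM, -⟩ := he s(u, v) huv
    exact ⟨M, hM⟩
  · push Not at hB
    have hs : Subsingleton V := by
      refine ⟨fun a b => ?_⟩
      obtain ⟨p⟩ := hc.preconnected a b
      cases p with
      | nil => rfl
      | cons h _ => exact absurd h (hB _ _)
    have := hc.nonempty
    have h1 := hk.card_mod_two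
    rw [Nat.card_unique (α := V), Nat.card_prod, Nat.card_fin, Nat.card_fin, mul_assoc,
      Nat.mul_mod_right] at h1
    omega

/-- The complete bipartite graph `K_{5,5}` is not a matching minor of any shallow vortex matching
grid, i.e. it is not a shallow vortex matching minor; and for every shallow vortex matching minor
`B` the maximum `μ(B)` exists (so that `μ(B)` is a genuine maximum) and is at most `4`. -/
theorem corollary6p9 :
    (∀ k : ℕ, ¬ IsMatchingMinor (completeBipartiteGraph (Fin 5) (Fin 5))
      (shallowVortexMatchingGrid k)) ∧
    ¬ IsShallowVortexMatchingMinor (completeBipartiteGraph (Fin 5) (Fin 5)) ∧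
    ∀ {V : Type*} (B : SimpleGraph V), IsShallowVortexMatchingMinor B →
      IsGreatest (bicliqueMatchingMinorOrders B) (bicliqueMatchingNumber B) ∧
        bicliqueMatchingNumber B ≤ 4 := by
  have main (k : ℕ) : ¬ IsMatchingMinor (completeBipartiteGraph (Fin 5) (Fin 5))
      (shallowVortexMatchingGrid k) :=
    fun h => not_hasMinor_K55_shallowVortexMatchingGrid k h.hasMinor
  refine ⟨main, fun ⟨_, _, k, hk⟩ => main k hk, fun {V} B hB => ?_⟩
  obtain ⟨M, hM⟩ := hB.exists_isPerfectMatching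
  obtain ⟨-, -, k, hk⟩ := hB
  have hle : ∀ t ∈ bicliqueMatchingMinorOrders B, t ≤ 4 := by
    intro t ht
    by_contra hlt
    exact not_hasMinor_K55_shallowVortexMatchingGrid k
      (((hasMinor_completeBipartiteGraph_of_le (by omega)).trans
        (IsMatchingMinor.hasMinor ht)).trans hk.hasMinor)
  have hmem : bicliqueMatchingNumber B ∈ bicliqueMatchingMinorOrders B :=
    Nat.sSup_mem ⟨0, zero_mem_bicliqueMatchingMinorOrders hM⟩ ⟨4, hle⟩
  exact ⟨⟨hmem, fun t ht => le_csSup ⟨4, hle⟩ ht⟩, hle _ hmem⟩
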